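/- Let $N\in\{2,3\}$, let $D_0\subset\mathbb R^N$ be a bounded, open, simply connected set, $\Omega_0\varsubsetneq D_0$ an open, simply connected set, and $S_0=D_0\setminus\overline{\Omega}_0$. The boundaries decompose as $\partial\Omega_0=I_0\cup\Gamma_0\cup O_0$, $\partial S_0=Z_0\cup\Sigma_0\cup\Gamma_0\cup\Pi_0$, $\partial D_0=I_0\cup Z_0\cup\Sigma_0\cup\Pi_0\cup O_0$, with $I_0,O_0\neq\emptyset$, $I_0\cup Z_0\subset\{x_1=0\}$, $O_0\cup\Pi_0\subset\{x_1=\ell\}$, and $\Gamma_0=\{x\in D_0:\gamma_0(x)=0\}$ for a function $\gamma_0\in C^2(\overline{D}_0)$. Let $$\Lambda=\Big\{\lambda\in C^2(\overline{D}_0,\mathbb R^N):\ \lambda=0\text{ on }\partial D_0,\ \sum_{j=2}^N\partial_1\lambda_j\,\partial_j\gamma_0=0\text{ on }\partial\Gamma_0\Big\},$$ where $\partial\Gamma_0=\overline{\Gamma}_0\setminus\Gamma_0$, with the norm of $C^2(\overline{D}_0,\mathbb R^N)$. Let $p_S^0\in\mathbb R$, $k_S>0$, $G_S>0$ with $k_S-\frac23G_S\ge0$,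 and for $U\in H^1(S_0,\mathbb R^N)$ set $$\epsilon^0_{ij}(U)=\Big(k_S-\tfrac23G_S\Big)(\nabla U)_{ij}\delta_{ij}+G_S\big((\nabla U)_{ij}+(\nabla U)_{ji}\big),\qquad \sigma^0_{ij}(U)=-p_S^0\delta_{ij}+\epsilon^0_{ij}(U)$$ (no summation over $i,j$). The equation $-\nabla\cdot T=0$ in $S_0$ is understood weakly: $\int_{S_0}T:\nabla W=0$ for all $W\in H^1_0(S_0,\mathbb R^N)$; and $U=g$ on $\partial S_0$ means that $U-G\in H^1_0(S_0,\mathbb R^N)$ for some extension $G\in C(\overline S_0)\cap C^1(S_0)\cap H^1(S_0)$ of $g$. For every $\mu\in\Lambda$ the problem $$-\nabla\cdot\sigma^0(U)=0\ \text{in }S_0,\qquad U=0\ \text{on }Z_0\cup\Sigma_0\cup\Pi_0,\qquad U=\mu\ \text{on }\Gamma_0$$ has a unique weak solution $U^0(\mu)\in H^1(S_0,\mathbb R^N)$. For every $\lambda\in\Lambda$ the map $\mu\mapsto U^0(\mu)$ is $C^1$ in a neighbourhood of $\lambda$, from $\Lambda$ to $H^1(S_0,\mathbb R^N)$. Furthermore,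 for every $\mu\in\Lambda$ the derivative $\dot U^0$ of $U^0$ at $\lambda$ in the direction $\mu$ satisfies, in the same weak sense, $$-\nabla\cdot\epsilon^0(\dot U^0)=0\ \text{in }S_0,\qquad \dot U^0=0\ \text{on }Z_0\cup\Sigma_0\cup\Pi_0,\qquad \dot U^0=\mu\ \text{on }\Gamma_0.$$ -/

import Mathlib

open MeasureTheory Topology
open scoped BoundedContinuousFunction ContDiff

set_option maxSynthPendingDepth 3

noncomputable section

namespace PoreElasticity

/-- Euclidean space `ℝᴺ`. -/
abbrev Euc (N : ℕ) : Type := EuclideanSpace ℝ (Fin N)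

/-- The `j`-th standard basis vector of `ℝᴺ`. -/
def e {N : ℕ} (j : Fin N) : Euc N := EuclideanSpace.single j 1

/-! ### The Banach space `C²(D̄, F)` -/

/-- Extension by zero of a function given on `closure D`. -/
def ext {N : ℕ} {D : Set (Euc N)} {F : Type*} [NormedAddCommGroup F]
    (f : ↥(closure D) →ᵇ F) : Euc N → F :=
  Function.extend Subtype.val f 0

lemma ext_apply {N : ℕ} {D : Set (Euc N)} {F : Type*} [NormedAddCommGroup F]
    (f : ↥(closure D) →ᵇ F) (x : ↥(closure D)) : ext f x = f x :=
  Subtype.val_injective.extend_apply f 0 x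

lemma ext_zero {N : ℕ} {D : Set (Euc N)} {F : Type*} [NormedAddCommGroup F] :
    ext (0 : ↥(closure D) →ᵇ F) = 0 := by
  funext x
  by_cases h : x ∈ closure D
  · simpa using ext_apply (0 : ↥(closure D) →ᵇ F) ⟨x, h⟩
  · exact Function.extend_apply' _ _ _ (by rintro ⟨y, rfl⟩; exact h y.2)

lemma ext_add {N : ℕ} {D : Set (Euc N)} {F : Type*} [NormedAddCommGroup F]
    (f g : ↥(closure D) →ᵇ F) : ext (f + g) = ext f + ext g := by
  funext x
  by_cases h : x ∈ closure D
  · simpa [ext_apply f ⟨x, h⟩, ext_apply g ⟨x, h⟩] using ext_apply (f + g) ⟨x, h⟩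
  · have hx : ¬ ∃ y : ↥(closure D), (y : Euc N) = x := by rintro ⟨y, rfl⟩; exact h y.2
    simp [ext, Function.extend_apply' _ _ _ hx]

lemma ext_smul {N : ℕ} {D : Set (Euc N)} {F : Type*} [NormedAddCommGroup F] [NormedSpace ℝ F]
    (c : ℝ) (f : ↥(closure D) →ᵇ F) : ext (c • f) = c • ext f := by
  funext x
  by_cases h : x ∈ closure D
  · simpa [ext_apply f ⟨x, h⟩] using ext_apply (c • f) ⟨x, h⟩
  · have hx : ¬ ∃ y : ↥(closure D), (y : Euc N) = x := by rintro ⟨y, rfl⟩; exact h y.2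
    simp [ext, Function.extend_apply' _ _ _ hx]

/-- The triples `(f, Df, D²f)` of bounded continuous functions on `D̄` such that on `D` the second
is the derivative of the first and the third is the derivative of the second. -/
def C2Sub {N : ℕ} (D : Set (Euc N)) (F : Type*) [NormedAddCommGroup F] [NormedSpace ℝ F] :
    Submodule ℝ ((↥(closure D) →ᵇ F) × (↥(closure D) →ᵇ (Euc N →L[ℝ] F)) ×
      (↥(closure D) →ᵇ (Euc N →L[ℝ] Euc N →L[ℝ] F))) where
  carrier := {p | ∀ x ∈ D, HasFDerivAt (ext p.1) (ext p.2.1 x) x ∧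
    HasFDerivAt (ext p.2.1) (ext p.2.2 x) x}
  zero_mem' := by
    intro x _
    simp only [Prod.fst_zero, Prod.snd_zero, ext_zero, Pi.zero_apply]
    exact ⟨hasFDerivAt_const _ _, hasFDerivAt_const _ _⟩
  add_mem' := by
    intro p q hp hq x hx
    simp only [Prod.fst_add, Prod.snd_add, ext_add, Pi.add_apply]
    exact ⟨(hp x hx).1.add (hq x hx).1, (hp x hx).2.add (hq x hx).2⟩
  smul_mem' := by
    intro c p hp x hx
    simp only [Prod.smul_fst, Prod.smul_snd, ext_smul, Pi.smul_apply]
    exact ⟨(hp x hx).1.const_smul c, (hp x hx).2.const_smul c⟩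

/-- The space `C²(D̄, F)` for an open set `D`: functions on `D̄` that are `C²` on `D` and whose
derivatives up to order two extend to bounded continuous functions on `D̄`. An element carries these
(uniquely determined) extensions of `Df` and `D²f`, and its norm is the maximum of the sup norms of
`f`, `Df` and `D²f`. -/
def C2 {N : ℕ} (D : Set (Euc N)) (F : Type*) [NormedAddCommGroup F] [NormedSpace ℝ F] : Type _ :=
  ↥(C2Sub D F)

instance {N : ℕ} (D : Set (Euc N)) (F : Type*) [NormedAddCommGroup F] [NormedSpace ℝ F] :
    NormedAddCommGroup (C2 D F) := Submodule.normedAddCommGroup (C2Sub D F)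

instance {N : ℕ} (D : Set (Euc N)) (F : Type*) [NormedAddCommGroup F] [NormedSpace ℝ F] :
    NormedSpace ℝ (C2 D F) := Submodule.normedSpace (C2Sub D F)

/-- The underlying function of an element of `C²(D̄, F)` (extended by zero outside `D̄`). -/
def C2.fn {N : ℕ} {D : Set (Euc N)} {F : Type*} [NormedAddCommGroup F] [NormedSpace ℝ F]
    (f : C2 D F) : Euc N → F := ext (Subtype.val f).1

/-- The derivative of an element of `C²(D̄, F)`, on `D̄` (extended by zero outside `D̄`). -/
def C2.deriv {N : ℕ} {D : Set (Euc N)} {F : Type*} [NormedAddCommGroup F] [NormedSpace ℝ F]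
    (f : C2 D F) : Euc N → (Euc N →L[ℝ] F) := ext (Subtype.val f).2.1

section

variable {N : ℕ} {D : Set (Euc N)} {F : Type*} [NormedAddCommGroup F] [NormedSpace ℝ F]

lemma C2.fn_zero : (0 : C2 D F).fn = 0 := ext_zero
lemma C2.deriv_zero : (0 : C2 D F).deriv = 0 := ext_zero
lemma C2.fn_add (f g : C2 D F) : (f + g).fn = f.fn + g.fn := ext_add _ _
lemma C2.deriv_add (f g : C2 D F) : (f + g).deriv = f.deriv + g.deriv := ext_add _ _
lemma C2.fn_smul (c : ℝ) (f : C2 D F) : (c • f).fn = c • f.fn := ext_smul _ _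
lemma C2.deriv_smul (c : ℝ) (f : C2 D F) : (c • f).deriv = c • f.deriv := ext_smul _ _

end

/-! ### The geometry and the space `Λ` of admissible deformations -/

/-- The reference configuration: the whole domain `D`, the channel `Ω ⊊ D`, the pieces
`I, Γ, O, Z, Σ, Π` (here `inlet, Gam, outlet, wallZ, wallS, wallP`) of the boundaries, and a `C²`
level-set function `γ` of the interface `Γ`. -/
structure Geometry (N : ℕ) [NeZero N] where
  /-- the whole domain -/
  D : Set (Euc N)
  /-- the channel -/
  Om : Set (Euc N)
  /-- boundary pieces -/
  inlet : Set (Euc N)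
  outlet : Set (Euc N)
  Gam : Set (Euc N)
  wallZ : Set (Euc N)
  wallS : Set (Euc N)
  wallP : Set (Euc N)
  /-- length of the device in the first coordinate direction -/
  len : ℝ
  /-- level-set function of the interface -/
  gam : C2 D ℝ
  D_open : IsOpen D
  D_bounded : Bornology.IsBounded D
  D_simplyConnected : IsSimplyConnected D
  Om_open : IsOpen Om
  Om_simplyConnected : IsSimplyConnected Om
  Om_ssubset : Om ⊂ D
  frontier_Om : frontier Om = inlet ∪ Gam ∪ outlet
  frontier_S : frontier (D \ closure Om) = wallZ ∪ wallS ∪ Gam ∪ wallP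
  frontier_D : frontier D = inlet ∪ wallZ ∪ wallS ∪ wallP ∪ outlet
  inlet_nonempty : inlet.Nonempty
  outlet_nonempty : outlet.Nonempty
  left_subset : inlet ∪ wallZ ⊆ {x | x 0 = 0}
  right_subset : outlet ∪ wallP ⊆ {x | x 0 = len}
  Gam_eq : Gam = {x | x ∈ D ∧ C2.fn gam x = 0}

/-- The elastomer `S = D \ Ω̄`. -/
def Geometry.S {N : ℕ} [NeZero N] (geo : Geometry N) : Set (Euc N) := geo.D \ closure geo.Om

/-- The space `Λ` of admissible deformations: all `λ ∈ C²(D̄, ℝᴺ)` with `λ = 0` on `∂D` and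
`∑_{j ≥ 2} ∂₁λⱼ ∂ⱼγ = 0` on `∂Γ = Γ̄ \ Γ` (the first coordinate has index `0`). It carries the
norm of `C²(D̄, ℝᴺ)`. -/
def Geometry.Adm {N : ℕ} [NeZero N] (geo : Geometry N) : Submodule ℝ (C2 geo.D (Euc N)) where
  carrier := {l | (∀ x ∈ frontier geo.D, C2.fn l x = 0) ∧
    ∀ x ∈ closure geo.Gam \ geo.Gam,
      ∑ j ∈ Finset.univ.erase (0 : Fin N),
        (C2.deriv l x (e 0)) j * C2.deriv geo.gam x (e j) = 0}
  zero_mem' := by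
    refine ⟨fun x _ => ?_, fun x _ => ?_⟩
    · simp [C2.fn_zero]
    · simp [C2.deriv_zero]
  add_mem' := by
    rintro a b ⟨ha, ha'⟩ ⟨hb, hb'⟩
    refine ⟨fun x hx => ?_, fun x hx => ?_⟩
    · simp [C2.fn_add, ha x hx, hb x hx]
    · simp [C2.deriv_add, add_mul, Finset.sum_add_distrib, ha' x hx, hb' x hx]
  smul_mem' := by
    rintro c a ⟨ha, ha'⟩
    refine ⟨fun x hx => ?_, fun x hx => ?_⟩
    · simp [C2.fn_smul, ha x hx]
    · simp [C2.deriv_smul, mul_assoc, ← Finset.mul_sum, ha' x hx]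

/-! ### The Sobolev spaces `H¹(S, ℝᴺ)` and `H¹₀(S, ℝᴺ)` -/

/-- `g` is the weak partial derivative `∂ⱼu` of `u` in `S`. -/
def IsWeakPartial {N : ℕ} (S : Set (Euc N)) (u g : Euc N → Euc N) (j : Fin N) : Prop :=
  ∀ φ : Euc N → ℝ, ContDiff ℝ ∞ φ → HasCompactSupport φ → tsupport φ ⊆ S →
    ∫ x in S, (fderiv ℝ φ x (e j)) • u x = - ∫ x in S, φ x • g x

/-- `L²(S, ℝᴺ)`. -/
abbrev L2 {N : ℕ} (S : Set (Euc N)) : Type := ↥(Lp (Euc N) 2 (volume.restrict S))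

lemma integrable_test_smul {N : ℕ} {S : Set (Euc N)} {φ : Euc N → ℝ} (hφ : Continuous φ)
    (hc : HasCompactSupport φ) (u : L2 S) :
    Integrable (fun x => φ x • u x) (volume.restrict S) :=
  ((Lp.memLp u).locallyIntegrable one_le_two).integrable_smul_left_of_hasCompactSupport hφ hc

lemma continuous_partial {N : ℕ} {φ : Euc N → ℝ} (hφ : ContDiff ℝ ∞ φ) (j : Fin N) :
    Continuous (fun x => fderiv ℝ φ x (e j)) :=
  (hφ.continuous_fderiv (by simp)).clm_apply continuous_const

lemma IsWeakPartial.zero {N : ℕ} (S : Set (Euc N)) (j : Fin N) :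
    IsWeakPartial S (0 : L2 S) (0 : L2 S) j := by
  intro φ _ _ _
  have h : ∀ ψ : Euc N → ℝ, ∫ x in S, ψ x • (0 : L2 S) x = 0 := by
    intro ψ
    refine integral_eq_zero_of_ae ?_
    filter_upwards [Lp.coeFn_zero (Euc N) 2 (volume.restrict S)] with x hx
    rw [hx]
    simp
  rw [h, h, neg_zero]

lemma IsWeakPartial.add {N : ℕ} {S : Set (Euc N)} {u v g h : L2 S} {j : Fin N}
    (hu : IsWeakPartial S u g j) (hv : IsWeakPartial S v h j) :
    IsWeakPartial S (u + v : L2 S) (g + h : L2 S) j := by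
  intro φ h1 h2 h3
  have key : ∀ (ψ : Euc N → ℝ), Continuous ψ → HasCompactSupport ψ → ∀ a b : L2 S,
      ∫ x in S, ψ x • (a + b : L2 S) x = (∫ x in S, ψ x • a x) + ∫ x in S, ψ x • b x := by
    intro ψ hψ hc a b
    rw [← integral_add (integrable_test_smul hψ hc a) (integrable_test_smul hψ hc b)]
    refine integral_congr_ae ?_
    filter_upwards [Lp.coeFn_add a b] with x hx
    rw [hx, Pi.add_apply, smul_add]
  have hd : HasCompactSupport (fun x => fderiv ℝ φ x (e j)) := h2.fderiv_apply ℝ (e j)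
  rw [key _ (continuous_partial h1 j) hd, key φ h1.continuous h2, hu φ h1 h2 h3, hv φ h1 h2 h3,
    neg_add]

lemma IsWeakPartial.smul {N : ℕ} {S : Set (Euc N)} {u g : L2 S} {j : Fin N} (c : ℝ)
    (hu : IsWeakPartial S u g j) : IsWeakPartial S (c • u : L2 S) (c • g : L2 S) j := by
  intro φ h1 h2 h3
  have key : ∀ (ψ : Euc N → ℝ) (a : L2 S),
      ∫ x in S, ψ x • (c • a : L2 S) x = c • ∫ x in S, ψ x • a x := by
    intro ψ a
    rw [← integral_smul]
    refine integral_congr_ae ?_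
    filter_upwards [Lp.coeFn_smul c a] with x hx
    simp only [hx, Pi.smul_apply, smul_comm (ψ x) c]
  rw [key, key φ, hu φ h1 h2 h3, smul_neg]

/-- `H¹(S, ℝᴺ)`: pairs of `u ∈ L²` and the family `(∂ⱼu)ⱼ` of its weak partial derivatives in
`L²`, with `‖u‖² = ‖u‖²_{L²} + ∑ⱼ ‖∂ⱼu‖²_{L²}`. -/
def H1 {N : ℕ} (S : Set (Euc N)) :
    Submodule ℝ (WithLp 2 (L2 S × PiLp 2 (fun _ : Fin N => L2 S))) where
  carrier := {u | ∀ j, IsWeakPartial S u.fst (u.snd j) j}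
  zero_mem' := fun j => IsWeakPartial.zero S j
  add_mem' := fun hu hv j => (hu j).add (hv j)
  smul_mem' := fun c _ hu j => (hu j).smul c

/-- The underlying function of `u ∈ H¹(S, ℝᴺ)`. -/
def H1.fn {N : ℕ} {S : Set (Euc N)} (u : ↥(H1 S)) : Euc N → Euc N := u.1.fst

/-- The weak gradient of `u ∈ H¹(S, ℝᴺ)`: the entry `(i, j)` is `∂ⱼuᵢ`. -/
def H1.grad {N : ℕ} {S : Set (Euc N)} (u : ↥(H1 S)) (x : Euc N) : Matrix (Fin N) (Fin N) ℝ :=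
  Matrix.of fun i j => (u.1.snd j : L2 S) x i

/-- The elements of `H¹(S, ℝᴺ)` that are represented by `C^∞` vector fields with compact support
in `S`. -/
def testFields {N : ℕ} (S : Set (Euc N)) : Submodule ℝ ↥(H1 S) where
  carrier := {u | ∃ φ : Euc N → Euc N, ContDiff ℝ ∞ φ ∧ HasCompactSupport φ ∧ tsupport φ ⊆ S ∧
    H1.fn u =ᵐ[volume.restrict S] φ}
  zero_mem' := by
    refine ⟨0, contDiff_const, HasCompactSupport.zero, by simp [tsupport], ?_⟩
    exact Lp.coeFn_zero (Euc N) 2 (volume.restrict S)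
  add_mem' := by
    rintro u v ⟨φ, a1, a2, a3, a4⟩ ⟨ψ, b1, b2, b3, b4⟩
    refine ⟨φ + ψ, a1.add b1, a2.add b2, (tsupport_add φ ψ).trans (Set.union_subset a3 b3), ?_⟩
    exact (Lp.coeFn_add u.1.fst v.1.fst).trans (a4.add b4)
  smul_mem' := by
    rintro c u ⟨φ, a1, a2, a3, a4⟩
    refine ⟨c • φ, contDiff_const.smul a1, a2.smul_left (f := fun _ => c),
      (closure_mono (Function.support_const_smul_subset c φ)).trans a3, ?_⟩
    exact (Lp.coeFn_smul c u.1.fst).trans (a4.const_smul c)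

/-- `H¹₀(S, ℝᴺ)`: the closure in `H¹(S, ℝᴺ)` of the smooth compactly supported fields. -/
def H10 {N : ℕ} (S : Set (Euc N)) : Submodule ℝ ↥(H1 S) := (testFields S).topologicalClosure

/-- `u = g` on `∂S` in the sense of `H¹`: the boundary function `g` extends to some
`G ∈ C(S̄) ∩ C¹(S) ∩ H¹(S, ℝᴺ)` such that `u - G ∈ H¹₀(S, ℝᴺ)`. -/
def HasBoundaryValues {N : ℕ} (S : Set (Euc N)) (u : ↥(H1 S)) (g : Euc N → Euc N) : Prop :=
  ∃ (Phi : ↥(H1 S)) (G : Euc N → Euc N),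
    ContinuousOn G (closure S) ∧ ContDiffOn ℝ 1 G S ∧
    H1.fn Phi =ᵐ[volume.restrict S] G ∧
    (∀ x ∈ frontier S, G x = g x) ∧
    u - Phi ∈ H10 S

/-! ### The elasticity system -/

/-- The elastic tensor
`ε_{ij}(u) = (k - (2/3) G) (∇u)_{ij} δ_{ij} + G ((∇u)_{ij} + (∇u)_{ji})`. -/
def eps {N : ℕ} {S : Set (Euc N)} (k G : ℝ) (u : ↥(H1 S)) (x : Euc N) :
    Matrix (Fin N) (Fin N) ℝ :=
  Matrix.of fun i j =>
    (k - 2 / 3 * G) * H1.grad u x i j * (if i = j then 1 else 0) +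
      G * (H1.grad u x i j + H1.grad u x j i)

/-- The first Piola-Kirchhoff stress tensor `σ_{ij}(u) = -p δ_{ij} + ε_{ij}(u)`. -/
def sigma {N : ℕ} {S : Set (Euc N)} (p k G : ℝ) (u : ↥(H1 S)) (x : Euc N) :
    Matrix (Fin N) (Fin N) ℝ :=
  Matrix.of fun i j => -p * (if i = j then 1 else 0) + eps k G u x i j

/-- `-∇·T = 0` in `S` in the weak sense: `∫_S T : ∇W = 0` for all `W ∈ H¹₀(S, ℝᴺ)`. -/
def WeakDivFree {N : ℕ} (S : Set (Euc N)) (T : Euc N → Matrix (Fin N) (Fin N) ℝ) : Prop :=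
  ∀ W ∈ H10 S, ∫ x in S, ∑ i, ∑ j, T x i j * H1.grad W x i j = 0

/-- The boundary conditions `u = 0` on `Z ∪ Σ ∪ Π` and `u = μ` on `Γ`. -/
def Geometry.DirichletCondition {N : ℕ} [NeZero N] (geo : Geometry N) (u : ↥(H1 geo.S))
    (mu : ↥geo.Adm) : Prop :=
  ∃ g : Euc N → Euc N, (∀ x ∈ geo.wallZ ∪ geo.wallS ∪ geo.wallP, g x = 0) ∧
    (∀ x ∈ geo.Gam, g x = C2.fn mu.1 x) ∧ HasBoundaryValues geo.S u g

/-- `u` is a weak solution of `-∇·σ(u) = 0` in `S`, `u = 0` on `Z ∪ Σ ∪ Π`, `u = μ` on `Γ`. -/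
def Geometry.IsWeakSolution {N : ℕ} [NeZero N] (geo : Geometry N) (p k G : ℝ) (mu : ↥geo.Adm)
    (u : ↥(H1 geo.S)) : Prop :=
  WeakDivFree geo.S (sigma p k G u) ∧ geo.DirichletCondition u mu

end PoreElasticity

end

/-!
The solution operator `μ ↦ U⁰(μ)` turns out to be the restriction of a continuous linear map, so it
is its own derivative, and the derivative solves the same boundary value problem. A constant
pressure drops out of the weak equation because `∫_S div W = 0` for `W ∈ H¹₀(S)`
(`weakDivFree_sigma_iff`); this is why the operator is linear and not just affine.

Existence. Since `μ` vanishes on `∂D`, the restriction of `μ` to `S` is itself an admissible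
extension of the boundary data; it lies in `H¹(S)` and depends linearly and continuously on `μ`
(`exists_restrictH1`). The form `∫_S ε(u) : ∇W` is coercive on `H¹₀(S)`
(`exists_elasticForm_coercive`): for test fields two integrations by parts give
`∫ ∂ᵢWⱼ ∂ⱼWᵢ = ∫ ∂ᵢWᵢ ∂ⱼWⱼ`, so that the energy is at least `G ∫ |∇W|²`, and this controls the full
norm by Poincaré's inequality. The Lax-Milgram theorem then corrects the extension by an element of
`H¹₀(S)` (`exists_correction_of_coercive`).

Uniqueness. Two solutions may come with different extensions of the boundary data. Their difference
is a field in `H¹(S)` that is continuous on `S̄`, `C¹` in `S` and zero on `∂S`, and such a field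
belongs to `H¹₀(S)` for every bounded open set `S` (`mem_H10_of_eq_zero_on_frontier`). The proof
truncates the values of the field near zero, which yields compactly supported `C¹` fields, and these
are in `H¹₀(S)` by mollification. Their derivatives converge in `L²` to the derivative of the field
cut off where the field vanishes; as weak derivatives are unique, the limit is the derivative itself.
-/

namespace PoreElasticity

/-! ### Weak derivatives and the Hilbert space `H¹` -/

section WeakDerivatives

variable {N : ℕ} {S : Set (Euc N)}

lemma integrable_smul_of_tsupport_subset {F : Type*} [NormedAddCommGroup F] [NormedSpace ℝ F]
    {φ : Euc N → ℝ} {g : Euc N → F} (hS : IsOpen S) (hφ : Continuous φ)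
    (hc : HasCompactSupport φ) (hs : tsupport φ ⊆ S) (hg : ContinuousOn g S) :
    Integrable (fun x => φ x • g x) volume := by
  have hcont : Continuous (fun x => φ x • g x) := by
    refine continuous_of_tsupport fun x hx => ?_
    have hx' : x ∈ tsupport φ := (tsupport_smul_subset_left φ g) hx
    exact hφ.continuousAt.smul (hg.continuousAt (hS.mem_nhds (hs hx')))
  exact hcont.integrable_of_hasCompactSupport (hc.smul_right (f' := g))

lemma setIntegral_smul_eq_integral {F : Type*} [NormedAddCommGroup F] [NormedSpace ℝ F]
    {φ : Euc N → ℝ} (hs : tsupport φ ⊆ S) (g : Euc N → F) :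
    ∫ x in S, φ x • g x = ∫ x, φ x • g x := by
  refine setIntegral_eq_integral_of_forall_compl_eq_zero fun x hx => ?_
  rw [image_eq_zero_of_notMem_tsupport (fun h => hx (hs h)), zero_smul]

lemma tsupport_partial_subset (φ : Euc N → ℝ) (j : Fin N) :
    tsupport (fun x => fderiv ℝ φ x (e j)) ⊆ tsupport φ :=
  tsupport_fderiv_apply_subset ℝ (e j)

/-- A classical partial derivative is a weak partial derivative. -/
lemma isWeakPartial_of_hasFDerivAt (hS : IsOpen S) {G : Euc N → Euc N}
    {G' : Euc N → Euc N →L[ℝ] Euc N} (hG : ∀ x ∈ S, HasFDerivAt G (G' x) x)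
    (hG' : ContinuousOn G' S) (j : Fin N) : IsWeakPartial S G (fun x => G' x (e j)) j := by
  intro φ h1 h2 h3
  have h3' := (tsupport_partial_subset φ j).trans h3
  rw [setIntegral_smul_eq_integral h3', setIntegral_smul_eq_integral h3]
  have hGc : ContinuousOn G S := fun x hx => (hG x hx).continuousAt.continuousWithinAt
  have hd : HasCompactSupport (fun x => fderiv ℝ φ x (e j)) := h2.fderiv_apply ℝ (e j)
  have hdiff : Differentiable ℝ φ := h1.differentiable (by simp)
  have := integral_bilinear_hasFDerivAt_right_eq_neg_left_of_integrable (μ := volume)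
    (B := ContinuousLinearMap.lsmul ℝ ℝ) (f := φ) (f' := fderiv ℝ φ) (g := G) (g' := G')
    (v := e j)
    (integrable_smul_of_tsupport_subset hS (continuous_partial h1 j) hd h3' hGc)
    (integrable_smul_of_tsupport_subset hS h1.continuous h2 h3
      (hG'.clm_apply continuousOn_const))
    (integrable_smul_of_tsupport_subset hS h1.continuous h2 h3 hGc)
    (fun x _ => (hdiff x).hasFDerivAt) (fun x hx => hG x (h3 hx))
  simp only [ContinuousLinearMap.lsmul_apply] at this
  rw [this, neg_neg]

lemma IsWeakPartial.congr {u v g h : Euc N → Euc N} {j : Fin N} (hu : IsWeakPartial S u g j)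
    (huv : u =ᵐ[volume.restrict S] v) (hgh : g =ᵐ[volume.restrict S] h) :
    IsWeakPartial S v h j := by
  intro φ h1 h2 h3
  have := hu φ h1 h2 h3
  rw [integral_congr_ae (huv.mono fun x hx => congrArg (fderiv ℝ φ x (e j) • ·) hx),
    integral_congr_ae (hgh.mono fun x hx => congrArg (φ x • ·) hx)] at this
  exact this

/-- Weak partial derivatives are unique. -/
lemma IsWeakPartial.ae_eq (hS : IsOpen S) {u g h : Euc N → Euc N} {j : Fin N}
    (hg : IsWeakPartial S u g j) (hh : IsWeakPartial S u h j)
    (hgi : LocallyIntegrableOn g S) (hhi : LocallyIntegrableOn h S) :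
    g =ᵐ[volume.restrict S] h := by
  have key : ∀ᵐ x, x ∈ S → g x - h x = 0 := by
    refine hS.ae_eq_zero_of_integral_contDiff_smul_eq_zero (hgi.sub hhi) fun φ h1 h2 h3 => ?_
    have hi : ∀ f : Euc N → Euc N, LocallyIntegrableOn f S →
        Integrable (fun x => φ x • f x) volume := by
      intro f hf
      have := (hf.mono_set h3).integrableOn_isCompact h2.isCompact
      have h4 : IntegrableOn (fun x => φ x • f x) (tsupport φ) volume :=
        this.continuousOn_smul h1.continuous.continuousOn h2.isCompact
      refine (integrableOn_iff_integrable_of_support_subset ?_).1 h4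
      exact (Function.support_smul_subset_left φ f).trans (subset_tsupport φ)
    have e1 := (hg φ h1 h2 h3).symm.trans (hh φ h1 h2 h3)
    rw [setIntegral_smul_eq_integral h3, setIntegral_smul_eq_integral h3, neg_inj] at e1
    simp only [smul_sub]
    rw [integral_sub (hi g hgi) (hi h hhi), e1, sub_self]
  filter_upwards [(ae_restrict_iff' hS.measurableSet).2 key] with x hx
  exact sub_eq_zero.1 hx

lemma L2.locallyIntegrableOn (u : L2 S) : LocallyIntegrableOn u S := by
  have := (Lp.memLp u).locallyIntegrable one_le_two
  exact (locallyIntegrableOn_of_locallyIntegrable_restrict this)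

lemma continuous_setIntegral_smul {ψ : Euc N → ℝ} (hψ : Continuous ψ)
    (hc : HasCompactSupport ψ) : Continuous fun u : L2 S => ∫ x in S, ψ x • u x := by
  have hm : MemLp ψ 2 (volume.restrict S) := hψ.memLp_of_hasCompactSupport hc
  have h : (fun u : L2 S => ∫ x in S, ψ x • u x) = fun u =>
      (ContinuousLinearMap.lsmul ℝ ℝ : ℝ →L[ℝ] Euc N →L[ℝ] Euc N).lpPairing
        (volume.restrict S) 2 2 (hm.toLp ψ) u := by
    funext u
    rw [ContinuousLinearMap.lpPairing_eq_integral]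
    refine integral_congr_ae ?_
    filter_upwards [hm.coeFn_toLp] with x hx
    simp [hx]
  rw [h]
  exact ContinuousLinearMap.continuous _

lemma isClosed_H1 : IsClosed (H1 S : Set (WithLp 2 (L2 S × PiLp 2 (fun _ : Fin N => L2 S)))) := by
  have : (H1 S : Set (WithLp 2 (L2 S × PiLp 2 (fun _ : Fin N => L2 S)))) =
      {u | ∀ j, IsWeakPartial S u.fst (u.snd j) j} := rfl
  rw [this]
  simp only [IsWeakPartial, Set.ofPred_forall]
  refine isClosed_iInter fun j => isClosed_iInter fun φ => isClosed_iInter fun h1 =>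
    isClosed_iInter fun h2 => isClosed_iInter fun _ => isClosed_eq ?_ ?_
  · exact (continuous_setIntegral_smul (continuous_partial h1 j) (h2.fderiv_apply ℝ (e j))).comp
      (WithLp.fstL 2 ℝ (L2 S) (PiLp 2 (fun _ : Fin N => L2 S))).continuous
  · exact ((continuous_setIntegral_smul h1.continuous h2).comp
      ((PiLp.proj 2 (𝕜 := ℝ) (fun _ : Fin N => L2 S) j).continuous.comp
      (WithLp.sndL 2 ℝ (L2 S) (PiLp 2 (fun _ : Fin N => L2 S))).continuous)).neg

instance : CompleteSpace ↥(H1 S) := isClosed_H1.completeSpace_coe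

instance : CompleteSpace ↥(H10 S) :=
  (Submodule.isClosed_topologicalClosure (testFields S)).completeSpace_coe

/-- The inclusion `H¹ → L²`. -/
noncomputable def H1.toL2 (S : Set (Euc N)) : ↥(H1 S) →L[ℝ] L2 S :=
  (WithLp.fstL 2 ℝ (L2 S) (PiLp 2 (fun _ : Fin N => L2 S))) ∘L (H1 S).subtypeL

/-- The weak partial derivative `∂ⱼ : H¹ → L²`. -/
noncomputable def H1.partialL (S : Set (Euc N)) (j : Fin N) : ↥(H1 S) →L[ℝ] L2 S :=
  (PiLp.proj 2 (𝕜 := ℝ) (fun _ : Fin N => L2 S) j) ∘L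
    (WithLp.sndL 2 ℝ (L2 S) (PiLp 2 (fun _ : Fin N => L2 S))) ∘L (H1 S).subtypeL

/-- The element of `H¹` given by a function in `L²` and its weak partial derivatives. -/
noncomputable def H1.mk (u : L2 S) (g : Fin N → L2 S) (h : ∀ j, IsWeakPartial S u (g j) j) : ↥(H1 S) :=
  ⟨WithLp.toLp 2 (u, WithLp.toLp 2 g), h⟩

lemma H1.isWeakPartial (u : ↥(H1 S)) (j : Fin N) :
    IsWeakPartial S (H1.toL2 S u) (H1.partialL S j u) j := u.2 j

lemma H1.norm_sq (u : ↥(H1 S)) :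
    ‖u‖ ^ 2 = ‖H1.toL2 S u‖ ^ 2 + ∑ j, ‖H1.partialL S j u‖ ^ 2 := by
  rw [show ‖u‖ = ‖u.1‖ from rfl, WithLp.prod_norm_sq_eq_of_L2, PiLp.norm_sq_eq_of_L2]
  rfl

/-- The weak partial derivatives of an element of `H¹` represented by a `C¹` function are the
classical ones. -/
lemma H1.partialL_ae_eq (hS : IsOpen S) {G : Euc N → Euc N} {G' : Euc N → Euc N →L[ℝ] Euc N}
    (hG : ∀ x ∈ S, HasFDerivAt G (G' x) x) (hG' : ContinuousOn G' S) {u : ↥(H1 S)}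
    (hu : H1.toL2 S u =ᵐ[volume.restrict S] G) (j : Fin N) :
    H1.partialL S j u =ᵐ[volume.restrict S] fun x => G' x (e j) := by
  refine IsWeakPartial.ae_eq hS ((H1.isWeakPartial u j).congr hu .rfl)
    (isWeakPartial_of_hasFDerivAt hS hG hG' j) (L2.locallyIntegrableOn _) ?_
  exact (hG'.clm_apply continuousOn_const).locallyIntegrableOn hS.measurableSet

/-- An element of `H¹` is determined by its underlying function. -/
lemma H1.ext_toL2 (hS : IsOpen S) {u v : ↥(H1 S)} (h : H1.toL2 S u = H1.toL2 S v) : u = v := by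
  have hp : ∀ j, H1.partialL S j u = H1.partialL S j v := fun j => by
    refine Lp.ext (IsWeakPartial.ae_eq hS (H1.isWeakPartial u j) ?_
      (L2.locallyIntegrableOn _) (L2.locallyIntegrableOn _))
    rw [h]
    exact H1.isWeakPartial v j
  have := H1.norm_sq (u - v)
  simp only [map_sub, h, hp, sub_self, norm_zero] at this
  simpa [sub_eq_zero] using this

end WeakDerivatives

/-! ### Convergence in `H¹` and construction of elements of `H¹` -/

section Convergence

variable {N : ℕ} {S : Set (Euc N)}

lemma L2.norm_sq_eq_integral (u : L2 S) : ‖u‖ ^ 2 = ∫ x in S, ‖u x‖ ^ 2 := by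
  rw [← real_inner_self_eq_norm_sq, L2.inner_def]
  simp_rw [real_inner_self_eq_norm_sq]

/-- Dominated convergence in `L²`. -/
lemma L2.tendsto_of_dominated {f : ℕ → L2 S} {f₀ : L2 S} {b : Euc N → ℝ}
    (hb : MemLp b 2 (volume.restrict S)) (hfb : ∀ n, ∀ᵐ x ∂volume.restrict S, ‖f n x‖ ≤ b x)
    (hlim : ∀ᵐ x ∂volume.restrict S, Filter.Tendsto (fun n => f n x) Filter.atTop (𝓝 (f₀ x))) :
    Filter.Tendsto f Filter.atTop (𝓝 f₀) := by
  rw [tendsto_iff_norm_sub_tendsto_zero]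
  have key : Filter.Tendsto (fun n => ‖f n - f₀‖ ^ 2) Filter.atTop (𝓝 0) := by
    simp_rw [L2.norm_sq_eq_integral]
    have h0 : (0 : ℝ) = ∫ x in S, (0 : ℝ) := by simp
    rw [h0]
    refine tendsto_integral_of_dominated_convergence (fun x => (b x + ‖f₀ x‖) ^ 2) ?_ ?_ ?_ ?_
    · exact fun n => (Lp.aestronglyMeasurable _).norm.pow 2
    · exact (hb.add (Lp.memLp f₀).norm).integrable_sq
    · intro n
      filter_upwards [hfb n, Lp.coeFn_sub (f n) f₀] with x h1 h2
      rw [h2, Pi.sub_apply, norm_pow, norm_norm]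
      gcongr
      exact (norm_sub_le _ _).trans (by gcongr)
    · have hall : ∀ᵐ x ∂volume.restrict S, ∀ n, (f n - f₀ : L2 S) x = f n x - f₀ x :=
        ae_all_iff.2 fun n => Lp.coeFn_sub (f n) f₀
      filter_upwards [hall, hlim] with x h1 h2
      simp_rw [h1]
      simpa using ((h2.sub_const (f₀ x)).norm.pow 2)
  have := key.sqrt
  simpa [Real.sqrt_sq] using this

/-- If a sequence in `H¹` and its partial derivatives converge in `L²`, then the sequence converges
in `H¹`: the `L²` limits of the derivatives need not be identified beforehand. -/
lemma H1.tendsto_of_tendsto_L2 (hS : IsOpen S) {v : ℕ → ↥(H1 S)} {u : ↥(H1 S)}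
    {g : Fin N → L2 S}
    (h0 : Filter.Tendsto (fun n => H1.toL2 S (v n)) Filter.atTop (𝓝 (H1.toL2 S u)))
    (h1 : ∀ j, Filter.Tendsto (fun n => H1.partialL S j (v n)) Filter.atTop (𝓝 (g j))) :
    Filter.Tendsto v Filter.atTop (𝓝 u) := by
  let P : WithLp 2 (L2 S × PiLp 2 (fun _ : Fin N => L2 S)) :=
    WithLp.toLp 2 (H1.toL2 S u, WithLp.toLp 2 g)
  have hP : Filter.Tendsto (fun n => (v n).1) Filter.atTop (𝓝 P) := by
    have e1 : Filter.Tendsto (fun n => (WithLp.toLp 2 fun j => H1.partialL S j (v n) :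
        PiLp 2 (fun _ : Fin N => L2 S))) Filter.atTop (𝓝 (WithLp.toLp 2 g)) :=
      ((PiLp.continuousLinearEquiv 2 ℝ (fun _ : Fin N => L2 S)).symm.continuous.tendsto g).comp
        (tendsto_pi_nhds.2 h1)
    exact ((WithLp.prodContinuousLinearEquiv 2 ℝ (L2 S)
      (PiLp 2 (fun _ : Fin N => L2 S))).symm.continuous.tendsto
        (H1.toL2 S u, WithLp.toLp 2 g)).comp (h0.prodMk_nhds e1)
  have hmem : P ∈ H1 S := isClosed_H1.mem_of_tendsto hP (Filter.Eventually.of_forall fun n => (v n).2)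
  have hu : u = ⟨P, hmem⟩ := H1.ext_toL2 hS rfl
  rw [tendsto_subtype_rng, hu]
  exact hP

/-- A classically differentiable function that is in `L²` together with its partial derivatives
defines an element of `H¹`. -/
lemma exists_H1_of_hasFDerivAt (hS : IsOpen S) {G : Euc N → Euc N}
    {G' : Euc N → Euc N →L[ℝ] Euc N} (hG : ∀ x ∈ S, HasFDerivAt G (G' x) x)
    (hG' : ContinuousOn G' S) (h0 : MemLp G 2 (volume.restrict S))
    (h1 : ∀ j, MemLp (fun x => G' x (e j)) 2 (volume.restrict S)) :
    ∃ u : ↥(H1 S), H1.toL2 S u =ᵐ[volume.restrict S] G ∧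
      ∀ j, H1.partialL S j u =ᵐ[volume.restrict S] fun x => G' x (e j) :=
  ⟨H1.mk (h0.toLp G) (fun j => (h1 j).toLp _) fun j =>
    (isWeakPartial_of_hasFDerivAt hS hG hG' j).congr h0.coeFn_toLp.symm
      (h1 j).coeFn_toLp.symm, h0.coeFn_toLp, fun j => (h1 j).coeFn_toLp⟩

lemma exists_H1_of_contDiff (hS : IsOpen S) {w : Euc N → Euc N} (hw : ContDiff ℝ 1 w)
    (hc : HasCompactSupport w) :
    ∃ u : ↥(H1 S), H1.toL2 S u =ᵐ[volume.restrict S] w ∧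
      ∀ j, H1.partialL S j u =ᵐ[volume.restrict S] fun x => fderiv ℝ w x (e j) := by
  have hd : Continuous (fderiv ℝ w) := hw.continuous_fderiv (by simp)
  exact exists_H1_of_hasFDerivAt hS
    (fun x _ => (hw.differentiable (by simp) x).hasFDerivAt) hd.continuousOn
    (hw.continuous.memLp_of_hasCompactSupport hc)
    (fun j => (hd.clm_apply continuous_const).memLp_of_hasCompactSupport (hc.fderiv_apply ℝ (e j)))

end Convergence

/-! ### Membership in `H¹₀` -/

section ZeroBoundaryValues

variable {N : ℕ} {S : Set (Euc N)}

lemma isClosed_H10 : IsClosed (H10 S : Set ↥(H1 S)) :=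
  Submodule.isClosed_topologicalClosure (testFields S)

lemma fderiv_normed_convolution (ρ : ContDiffBump (0 : Euc N)) {w : Euc N → Euc N}
    (hw : ContDiff ℝ 1 w) (hc : HasCompactSupport w) :
    fderiv ℝ (convolution (ρ.normed volume) w (ContinuousLinearMap.lsmul ℝ ℝ) volume) =
      convolution (ρ.normed volume) (fderiv ℝ w) (ContinuousLinearMap.lsmul ℝ ℝ) volume := by
  funext x
  rw [(hc.hasFDerivAt_convolution_right (ContinuousLinearMap.lsmul ℝ ℝ)
    ρ.continuous_normed.locallyIntegrable hw x).fderiv]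
  congr 1

lemma norm_normed_convolution_le {F : Type*} [NormedAddCommGroup F] [NormedSpace ℝ F]
    [CompleteSpace F] (ρ : ContDiffBump (0 : Euc N)) {w : Euc N → F} (hw : Continuous w)
    {M : ℝ} (hM : ∀ x, ‖w x‖ ≤ M) (x : Euc N) :
    ‖convolution (ρ.normed volume) w (ContinuousLinearMap.lsmul ℝ ℝ) volume x‖ ≤ 3 * M := by
  have h := ρ.dist_normed_convolution_le (μ := volume) (x₀ := x) (ε := 2 * M)
    hw.aestronglyMeasurable (fun y _ => by
      rw [dist_eq_norm]
      linarith [norm_sub_le (w y) (w x), hM x, hM y])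
  rw [dist_eq_norm] at h
  linarith [norm_le_norm_add_norm_sub' (convolution (ρ.normed volume) w
    (ContinuousLinearMap.lsmul ℝ ℝ) volume x) (w x), hM x]

/-- Compactly supported `C¹` fields belong to `H¹₀`, by mollification. -/
lemma mem_H10_of_contDiff (hS : IsOpen S) (hb : Bornology.IsBounded S) {w : Euc N → Euc N}
    (hw : ContDiff ℝ 1 w) (hc : HasCompactSupport w) (hs : tsupport w ⊆ S) {u : ↥(H1 S)}
    (hu : H1.toL2 S u =ᵐ[volume.restrict S] w) : u ∈ H10 S := by
  have : IsFiniteMeasure (volume.restrict S) := ⟨by simpa using hb.measure_lt_top⟩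
  obtain ⟨δ, hδ, hδS⟩ := hc.isCompact.exists_cthickening_subset_open hS hs
  let ρ : ℕ → ContDiffBump (0 : Euc N) := fun n =>
    ⟨δ / (n + 1) / 2, δ / (n + 1), by positivity, half_lt_self (by positivity)⟩
  have hρ : Filter.Tendsto (fun n => (ρ n).rOut) Filter.atTop (𝓝 0) :=
    tendsto_const_div_atTop_nhds_zero_nat δ |>.comp (Filter.tendsto_add_atTop_nat 1) |>.congr
      fun n => by simp [ρ]
  let wn : ℕ → Euc N → Euc N := fun n =>
    convolution ((ρ n).normed volume) w (ContinuousLinearMap.lsmul ℝ ℝ) volume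
  have hsm : ∀ n, ContDiff ℝ ∞ (wn n) := fun n =>
    (ρ n).hasCompactSupport_normed.contDiff_convolution_left _ (ρ n).contDiff_normed
      hw.continuous.locallyIntegrable
  have hcn : ∀ n, HasCompactSupport (wn n) := fun n =>
    (ρ n).hasCompactSupport_normed.convolution _ hc
  have hsn : ∀ n, tsupport (wn n) ⊆ S := by
    intro n
    refine Set.Subset.trans (closure_minimal ?_ Metric.isClosed_cthickening) hδS
    intro x hx
    obtain ⟨a, ha, b, hb, rfl⟩ := support_convolution_subset _ hx
    rw [(ρ n).support_normed_eq, mem_ball_zero_iff] at ha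
    refine Metric.mem_cthickening_of_dist_le _ b δ _ (subset_tsupport w hb) ?_
    have : δ / (n + 1) ≤ δ := div_le_self hδ.le (by linarith [n.cast_nonneg (α := ℝ)])
    simpa [dist_eq_norm] using ha.le.trans this
  have hdw : Continuous (fderiv ℝ w) := hw.continuous_fderiv (by simp)
  obtain ⟨M, hM⟩ := hc.exists_bound_of_continuous hw.continuous
  obtain ⟨M', hM'⟩ := (hc.fderiv ℝ).exists_bound_of_continuous hdw
  choose v hv hv' using fun n => exists_H1_of_contDiff hS ((hsm n).of_le (by simp)) (hcn n)
  have hlim : Filter.Tendsto v Filter.atTop (𝓝 u) := by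
    refine H1.tendsto_of_tendsto_L2 hS (g := fun j => H1.partialL S j u) ?_ fun j => ?_
    · refine L2.tendsto_of_dominated (memLp_const (3 * M)) (fun n => ?_) ?_
      · filter_upwards [hv n] with x hx
        rw [hx]
        exact norm_normed_convolution_le _ hw.continuous hM x
      · filter_upwards [ae_all_iff.2 hv, hu] with x hx hx'
        simp_rw [hx, hx']
        exact ContDiffBump.convolution_tendsto_right_of_continuous hρ hw.continuous x
    · have hpu := H1.partialL_ae_eq hS (fun x _ => (hw.differentiable (by simp) x).hasFDerivAt)
        hdw.continuousOn hu j
      have hj : ‖(e j : Euc N)‖ = 1 := by simp [e]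
      refine L2.tendsto_of_dominated (memLp_const (3 * M')) (fun n => ?_) ?_
      · filter_upwards [hv' n j] with x hx
        rw [hx, fderiv_normed_convolution _ hw hc]
        refine (ContinuousLinearMap.le_opNorm _ _).trans ?_
        rw [hj, mul_one]
        exact norm_normed_convolution_le _ hdw hM' x
      · filter_upwards [ae_all_iff.2 fun n => hv' n j, hpu] with x hx hx'
        simp_rw [hx, hx', wn, fderiv_normed_convolution _ hw hc]
        exact ((ContinuousLinearMap.apply ℝ (Euc N) (e j)).continuous.tendsto _).comp
          (ContDiffBump.convolution_tendsto_right_of_continuous hρ hdw x)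
  exact isClosed_H10.mem_of_tendsto hlim (Filter.Eventually.of_forall fun n =>
    (testFields S).le_topologicalClosure ⟨wn n, hsm n, hcn n, hsn n, hv n⟩)

end ZeroBoundaryValues

section Truncation

variable {N : ℕ} {S : Set (Euc N)}

/-- There is a smooth map `η` of `ℝᴺ` that vanishes near the origin, is the identity far from it
and has bounded derivative. The maps `y ↦ t η(y / t)` truncate small values as `t → 0`. -/
lemma exists_truncation (N : ℕ) : ∃ (η : Euc N → Euc N) (C : ℝ), ContDiff ℝ 1 η ∧
    (∀ y, ‖y‖ < 1 → η y = 0) ∧ (∀ y, 2 < ‖y‖ → η y = y) ∧ (∀ y, ‖η y‖ ≤ ‖y‖) ∧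
    ∀ y, ‖fderiv ℝ η y‖ ≤ C := by
  let β : ContDiffBump (0 : Euc N) := ⟨1, 2, one_pos, one_lt_two⟩
  have hβ : ContDiff ℝ 1 (β : Euc N → ℝ) := β.contDiff
  have hη : ContDiff ℝ 1 fun y : Euc N => (1 - β y) • y :=
    (contDiff_const.sub hβ).smul contDiff_id
  have h2 : ∀ y : Euc N, 2 < ‖y‖ → (1 - β y) • y = y := fun y hy => by
    rw [β.zero_of_le_dist (by rw [dist_zero_right]; exact hy.le)]
    simp
  obtain ⟨C, hC⟩ := (isCompact_closedBall (0 : Euc N) 2).exists_bound_of_continuousOn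
    (hη.continuous_fderiv (by simp)).continuousOn
  refine ⟨fun y => (1 - β y) • y, max C 1, hη, fun y hy => ?_, h2, fun y => ?_, fun y => ?_⟩
  · change (1 - β y) • y = 0
    rw [β.one_of_mem_closedBall (by simpa using hy.le)]
    simp
  · rw [norm_smul]
    refine mul_le_of_le_one_left (norm_nonneg y) ?_
    rw [Real.norm_eq_abs, abs_le]
    constructor <;> linarith [β.nonneg (x := y), β.le_one (x := y)]
  · by_cases hy : ‖y‖ ≤ 2
    · exact (hC y (by simpa using hy)).trans (le_max_left _ _)
    · push Not at hy
      have : (fun y : Euc N => (1 - β y) • y) =ᶠ[𝓝 y] id := by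
        filter_upwards [continuous_norm.continuousAt.eventually (lt_mem_nhds hy)] with z hz
        exact h2 z hz
      rw [this.fderiv_eq, fderiv_id]
      exact ContinuousLinearMap.norm_id_le.trans (le_max_right _ _)

/-- Let `w` be continuous on `S̄`, `C¹` in `S` and zero on `∂S`. If `η` is `C¹` and vanishes in the
unit ball, then `t η(w / t)` is a compactly supported `C¹` field in `S`. -/
lemma contDiff_truncation (hS : IsOpen S) (hb : Bornology.IsBounded S) {w η : Euc N → Euc N}
    (hw : ContinuousOn w (closure S)) (hw1 : ContDiffOn ℝ 1 w S) (hw0 : ∀ x ∈ frontier S, w x = 0)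
    (hη : ContDiff ℝ 1 η) (hη0 : ∀ y, ‖y‖ < 1 → η y = 0) {t : ℝ} (ht : 0 < t) :
    ContDiff ℝ 1 (S.indicator fun x => t • η (t⁻¹ • w x)) ∧
    HasCompactSupport (S.indicator fun x => t • η (t⁻¹ • w x)) ∧
    tsupport (S.indicator fun x => t • η (t⁻¹ • w x)) ⊆ S := by
  let K : Set (Euc N) := closure S ∩ (fun x => ‖w x‖) ⁻¹' Set.Ici t
  have hKc : IsClosed K := hw.norm.preimage_isClosed_of_isClosed isClosed_closure isClosed_Ici
  have hK : IsCompact K :=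
    Metric.isCompact_of_isClosed_isBounded hKc (hb.closure.subset Set.inter_subset_left)
  have hKS : K ⊆ S := by
    rintro x ⟨hx, hx'⟩
    by_contra hxS
    have : x ∈ frontier S := ⟨hx, by rwa [hS.interior_eq]⟩
    simp only [Set.mem_preimage, hw0 x this, norm_zero, Set.mem_Ici] at hx'
    linarith
  have hsupp : Function.support (S.indicator fun x => t • η (t⁻¹ • w x)) ⊆ K := by
    intro x hx
    rw [Set.support_indicator] at hx
    refine ⟨subset_closure hx.1, ?_⟩
    by_contra hlt
    simp only [Set.mem_preimage, Set.mem_Ici, not_le] at hlt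
    refine hx.2 ?_
    have : η (t⁻¹ • w x) = 0 := hη0 _ (by
      rw [norm_smul, norm_inv, Real.norm_of_nonneg ht.le, inv_mul_lt_one₀ ht]
      exact hlt)
    simp [this]
  have hts : tsupport (S.indicator fun x => t • η (t⁻¹ • w x)) ⊆ K := closure_minimal hsupp hKc
  refine ⟨contDiff_iff_contDiffAt.2 fun x => ?_, HasCompactSupport.of_support_subset_isCompact hK
    hsupp, hts.trans hKS⟩
  by_cases hx : x ∈ S
  · have h1 : ContDiffAt ℝ 1 (fun x => t • η (t⁻¹ • w x)) x :=
      (hη.contDiffAt.comp x ((hw1.contDiffAt (hS.mem_nhds hx)).const_smul t⁻¹)).const_smul t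
    refine h1.congr_of_eventuallyEq ?_
    filter_upwards [hS.mem_nhds hx] with y hy
    exact Set.indicator_of_mem hy _
  · have := notMem_tsupport_iff_eventuallyEq.1 fun h => hx (hKS (hts h))
    exact contDiffAt_const.congr_of_eventuallyEq this

lemma fderiv_truncation (hS : IsOpen S) {w η : Euc N → Euc N} (hw1 : ContDiffOn ℝ 1 w S)
    (hη : ContDiff ℝ 1 η) {t : ℝ} (ht : 0 < t) {x : Euc N} (hx : x ∈ S) :
    fderiv ℝ (S.indicator fun x => t • η (t⁻¹ • w x)) x =
      (fderiv ℝ η (t⁻¹ • w x)).comp (fderiv ℝ w x) := by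
  have h0 : S.indicator (fun x => t • η (t⁻¹ • w x)) =ᶠ[𝓝 x] fun x => t • η (t⁻¹ • w x) := by
    filter_upwards [hS.mem_nhds hx] with y hy
    exact Set.indicator_of_mem hy _
  have hwx : HasFDerivAt w (fderiv ℝ w x) x :=
    ((hw1.contDiffAt (hS.mem_nhds hx)).differentiableAt (by simp)).hasFDerivAt
  have hηx := (hη.differentiable (by simp) (t⁻¹ • w x)).hasFDerivAt
  have h1 : HasFDerivAt (fun x => t • η (t⁻¹ • w x))
      (t • (fderiv ℝ η (t⁻¹ • w x)).comp (t⁻¹ • fderiv ℝ w x)) x :=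
    (hηx.comp x (hwx.const_smul t⁻¹)).const_smul t
  rw [h0.fderiv_eq, h1.fderiv, ContinuousLinearMap.comp_smul, smul_smul, mul_inv_cancel₀ ht.ne', one_smul]

/-- An element of `H¹(S)` represented by a function that is continuous on `S̄`, `C¹` in `S` and zero
on `∂S` belongs to `H¹₀(S)`. No regularity of `∂S` is needed: the truncations `t η(w / t)` have
compact support in `S` and converge as `t → 0`. -/
theorem mem_H10_of_eq_zero_on_frontier (hS : IsOpen S) (hb : Bornology.IsBounded S)
    {w : Euc N → Euc N} (hw : ContinuousOn w (closure S)) (hw1 : ContDiffOn ℝ 1 w S)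
    (hw0 : ∀ x ∈ frontier S, w x = 0) {u : ↥(H1 S)}
    (hu : H1.toL2 S u =ᵐ[volume.restrict S] w) : u ∈ H10 S := by
  obtain ⟨η, C, hη, hη0, hη1, hηle, hηC⟩ := exists_truncation N
  let t : ℕ → ℝ := fun n => 1 / ((n : ℝ) + 1)
  have ht : ∀ n, 0 < t n := fun n => by positivity
  have htlim : Filter.Tendsto t Filter.atTop (𝓝 0) := tendsto_one_div_add_atTop_nhds_zero_nat
  have hbig : ∀ y : Euc N, y ≠ 0 → ∀ᶠ n in Filter.atTop, 2 < ‖(t n)⁻¹ • y‖ := by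
    intro y hy
    have hy' : 0 < ‖y‖ / 2 := by positivity
    filter_upwards [htlim.eventually (gt_mem_nhds hy')] with n hn
    rw [norm_smul, norm_inv, Real.norm_of_nonneg (ht n).le, inv_mul_eq_div, lt_div_iff₀ (ht n)]
    linarith
  let wn : ℕ → Euc N → Euc N := fun n => S.indicator fun x => t n • η ((t n)⁻¹ • w x)
  have hwn := fun n => contDiff_truncation hS hb hw hw1 hw0 hη hη0 (ht n)
  choose v hv hv' using fun n => exists_H1_of_contDiff hS (hwn n).1 (hwn n).2.1
  have hp := H1.partialL_ae_eq hS
    (fun x hx => ((hw1.contDiffAt (hS.mem_nhds hx)).differentiableAt (by simp)).hasFDerivAt)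
    (hw1.continuousOn_fderiv_of_isOpen hS (by simp)) hu
  have hS' : ∀ᵐ x ∂volume.restrict S, x ∈ S := ae_restrict_mem hS.measurableSet
  -- The derivatives converge to `∂ⱼw` where `w ≠ 0` and to zero elsewhere.
  have hmeas : MeasurableSet {x | H1.toL2 S u x ≠ 0} :=
    (Lp.stronglyMeasurable (H1.toL2 S u)).measurable (measurableSet_singleton 0).compl
  have hg : ∀ j, MemLp ({x | H1.toL2 S u x ≠ 0}.indicator (H1.partialL S j u)) 2
      (volume.restrict S) := fun j => (Lp.memLp (H1.partialL S j u)).indicator hmeas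
  have hlim : Filter.Tendsto v Filter.atTop (𝓝 u) := by
    refine H1.tendsto_of_tendsto_L2 hS (g := fun j => (hg j).toLp _) ?_ fun j => ?_
    · refine L2.tendsto_of_dominated (Lp.memLp (H1.toL2 S u)).norm (fun n => ?_) ?_
      · filter_upwards [hv n, hu, hS'] with x h1 h2 hx
        rw [h1, h2, Set.indicator_of_mem hx, norm_smul, Real.norm_of_nonneg (ht n).le]
        calc t n * ‖η ((t n)⁻¹ • w x)‖ ≤ t n * ‖(t n)⁻¹ • w x‖ :=
              mul_le_mul_of_nonneg_left (hηle _) (ht n).le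
          _ = ‖w x‖ := by
              rw [norm_smul, norm_inv, Real.norm_of_nonneg (ht n).le,
                mul_inv_cancel_left₀ (ht n).ne']
      · filter_upwards [ae_all_iff.2 hv, hu, hS'] with x h1 h2 hx
        simp_rw [h1, h2, Set.indicator_of_mem hx]
        by_cases h0 : w x = 0
        · simp [h0, hη0 0 (by simp)]
        · refine tendsto_const_nhds.congr' ?_
          filter_upwards [hbig _ h0] with n hn
          rw [hη1 _ hn, smul_inv_smul₀ (ht n).ne']
    · refine L2.tendsto_of_dominated ((Lp.memLp (H1.partialL S j u)).norm.const_mul C)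
        (fun n => ?_) ?_
      · filter_upwards [hv' n j, hp j, hS'] with x h1 h2 hx
        rw [h1, h2, fderiv_truncation hS hw1 hη (ht n) hx, ContinuousLinearMap.comp_apply]
        exact ContinuousLinearMap.le_of_opNorm_le _ (hηC _) _
      · filter_upwards [ae_all_iff.2 fun n => hv' n j, hp j, hu, (hg j).coeFn_toLp, hS']
          with x h1 h2 h3 h4 hx
        simp_rw [h1, h4, fderiv_truncation hS hw1 hη (ht _) hx, ContinuousLinearMap.comp_apply]
        by_cases h0 : w x = 0
        · have hfd : fderiv ℝ η 0 = 0 := by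
            have : η =ᶠ[𝓝 0] fun _ => 0 := by
              filter_upwards [Metric.ball_mem_nhds (0 : Euc N) one_pos] with y hy
              exact hη0 y (by simpa using hy)
            rw [this.fderiv_eq, fderiv_const_apply]
          rw [Set.indicator_of_notMem (by simp [h3, h0])]
          simp [h0, hfd]
        · rw [Set.indicator_of_mem (by simpa [h3] using h0), h2]
          refine tendsto_const_nhds.congr' ?_
          filter_upwards [hbig _ h0] with n hn
          have : η =ᶠ[𝓝 ((t n)⁻¹ • w x)] id := by
            filter_upwards [continuous_norm.continuousAt.eventually (lt_mem_nhds hn)] with z hz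
            exact hη1 z hz
          rw [this.fderiv_eq, fderiv_id, ContinuousLinearMap.id_apply]
  exact isClosed_H10.mem_of_tendsto hlim (Filter.Eventually.of_forall fun n =>
    mem_H10_of_contDiff hS hb (hwn n).1 (hwn n).2.1 (hwn n).2.2 (hv n))

end Truncation

/-! ### The elastic bilinear form and its coercivity on `H¹₀` -/

section ElasticForm

variable {N : ℕ} {S : Set (Euc N)}

/-- To prove a closed property for all elements of `H¹₀` it suffices to check it for smooth
compactly supported fields, whose weak derivatives are the classical ones. -/
lemma H10_induction (hS : IsOpen S) {P : ↥(H1 S) → Prop} (hP : IsClosed {u | P u})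
    (h : ∀ (u : ↥(H1 S)) (φ : Euc N → Euc N), ContDiff ℝ ∞ φ → HasCompactSupport φ →
      tsupport φ ⊆ S → H1.toL2 S u =ᵐ[volume.restrict S] φ →
      (∀ j, H1.partialL S j u =ᵐ[volume.restrict S] fun x => fderiv ℝ φ x (e j)) → P u)
    {u : ↥(H1 S)} (hu : u ∈ H10 S) : P u := by
  have hsub : (testFields S : Set ↥(H1 S)) ⊆ {u | P u} := by
    rintro v ⟨φ, h1, h2, h3, h4⟩
    exact h v φ h1 h2 h3 h4 (H1.partialL_ae_eq hS
      (fun x _ => (h1.differentiable (by simp) x).hasFDerivAt)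
      (h1.continuous_fderiv (by simp)).continuousOn h4)
  exact closure_minimal hsub hP hu

/-- The entry `∂ⱼuᵢ` of the weak gradient as a continuous linear map `H¹(S, ℝᴺ) → L²(S)`. -/
noncomputable def H1.gradL (S : Set (Euc N)) (i j : Fin N) :
    ↥(H1 S) →L[ℝ] Lp ℝ 2 (volume.restrict S) :=
  ((EuclideanSpace.proj i : Euc N →L[ℝ] ℝ).compLpL 2 (volume.restrict S)) ∘L H1.partialL S j

lemma H1.gradL_ae_eq (u : ↥(H1 S)) (i j : Fin N) :
    H1.gradL S i j u =ᵐ[volume.restrict S] fun x => H1.grad u x i j :=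
  ContinuousLinearMap.coeFn_compLpL _ _

lemma H1.gradL_ae_eq_of_partialL {u : ↥(H1 S)} {φ : Euc N → Euc N} {j : Fin N}
    (h : H1.partialL S j u =ᵐ[volume.restrict S] fun x => fderiv ℝ φ x (e j)) (i : Fin N) :
    H1.gradL S i j u =ᵐ[volume.restrict S] fun x => fderiv ℝ φ x (e j) i := by
  filter_upwards [H1.gradL_ae_eq u i j, h] with x h1 h2
  rw [h1, ← h2]
  rfl

lemma H1.norm_partialL_sq (u : ↥(H1 S)) (j : Fin N) :
    ‖H1.partialL S j u‖ ^ 2 = ∑ i, ‖H1.gradL S i j u‖ ^ 2 := by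
  simp_rw [← real_inner_self_eq_norm_sq (H1.gradL S _ j u), L2.norm_sq_eq_integral, L2.inner_def]
  rw [← integral_finsetSum _ fun i _ => L2.integrable_inner _ _]
  refine integral_congr_ae ?_
  filter_upwards [ae_all_iff.2 fun i => H1.gradL_ae_eq u i j] with x hx
  simp_rw [hx, real_inner_self_eq_norm_sq, EuclideanSpace.norm_sq_eq]
  rfl

/-- The entry `ε_{ij}` of the elastic tensor as a continuous linear map `H¹(S, ℝᴺ) → L²(S)`. -/
noncomputable def epsL (S : Set (Euc N)) (k G : ℝ) (i j : Fin N) :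
    ↥(H1 S) →L[ℝ] Lp ℝ 2 (volume.restrict S) :=
  ((k - 2 / 3 * G) * (if i = j then 1 else 0)) • H1.gradL S i j +
    G • (H1.gradL S i j + H1.gradL S j i)

lemma epsL_ae_eq (k G : ℝ) (u : ↥(H1 S)) (i j : Fin N) :
    epsL S k G i j u =ᵐ[volume.restrict S] fun x => eps k G u x i j := by
  have h : epsL S k G i j u = ((k - 2 / 3 * G) * (if i = j then 1 else 0)) • H1.gradL S i j u +
    G • (H1.gradL S i j u + H1.gradL S j i u) := rfl
  rw [h]
  filter_upwards [Lp.coeFn_add (((k - 2 / 3 * G) * (if i = j then 1 else 0)) • H1.gradL S i j u)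
    (G • (H1.gradL S i j u + H1.gradL S j i u)),
    Lp.coeFn_smul ((k - 2 / 3 * G) * (if i = j then 1 else 0)) (H1.gradL S i j u),
    Lp.coeFn_smul G (H1.gradL S i j u + H1.gradL S j i u),
    Lp.coeFn_add (H1.gradL S i j u) (H1.gradL S j i u), H1.gradL_ae_eq u i j,
    H1.gradL_ae_eq u j i] with x h1 h2 h3 h4 h5 h6
  rw [h1, Pi.add_apply, h2, h3, Pi.smul_apply, Pi.smul_apply, h4, Pi.add_apply, h5, h6]
  simp only [eps, Matrix.of_apply, smul_eq_mul]
  ring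

/-- The bilinear form `(u, W) ↦ ∫_S ε(u) : ∇W` on `H¹(S, ℝᴺ)`. -/
noncomputable def elasticForm (S : Set (Euc N)) (k G : ℝ) : ↥(H1 S) →L[ℝ] ↥(H1 S) →L[ℝ] ℝ :=
  ∑ i, ∑ j, (innerSL ℝ (E := Lp ℝ 2 (volume.restrict S))).bilinearComp (epsL S k G i j)
    (H1.gradL S i j)

lemma elasticForm_apply (k G : ℝ) (u W : ↥(H1 S)) :
    elasticForm S k G u W = ∑ i, ∑ j, inner ℝ (epsL S k G i j u) (H1.gradL S i j W) := by
  simp [elasticForm]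

lemma inner_epsL_gradL_ae_eq (k G : ℝ) (u W : ↥(H1 S)) (i j : Fin N) :
    (fun x => inner ℝ (epsL S k G i j u x) (H1.gradL S i j W x)) =ᵐ[volume.restrict S]
      fun x => eps k G u x i j * H1.grad W x i j := by
  filter_upwards [epsL_ae_eq k G u i j, H1.gradL_ae_eq W i j] with x h1 h2
  rw [h1, h2]
  exact mul_comm _ _

lemma integrable_eps_mul_grad (k G : ℝ) (u W : ↥(H1 S)) (i j : Fin N) :
    Integrable (fun x => eps k G u x i j * H1.grad W x i j) (volume.restrict S) :=
  (L2.integrable_inner (𝕜 := ℝ) (epsL S k G i j u) (H1.gradL S i j W)).congr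
    (inner_epsL_gradL_ae_eq k G u W i j)

lemma integral_eps_grad (k G : ℝ) (u W : ↥(H1 S)) :
    ∫ x in S, ∑ i, ∑ j, eps k G u x i j * H1.grad W x i j = elasticForm S k G u W := by
  rw [elasticForm_apply, integral_finsetSum _ fun i _ => integrable_finsetSum _ fun j _ =>
    integrable_eps_mul_grad k G u W i j]
  refine Finset.sum_congr rfl fun i _ => ?_
  rw [integral_finsetSum _ fun j _ => integrable_eps_mul_grad k G u W i j]
  refine Finset.sum_congr rfl fun j _ => ?_
  rw [L2.inner_def, integral_congr_ae (inner_epsL_gradL_ae_eq k G u W i j)]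

lemma weakDivFree_eps_iff (k G : ℝ) (u : ↥(H1 S)) :
    WeakDivFree S (eps k G u) ↔ ∀ W ∈ H10 S, elasticForm S k G u W = 0 := by
  simp_rw [WeakDivFree, integral_eps_grad]

/-- Each term `∂ᵢWᵢ` of the divergence of a field in `H¹₀` has mean zero. -/
lemma integral_grad_diag_eq_zero (hS : IsOpen S) (hb : Bornology.IsBounded S) {W : ↥(H1 S)}
    (hW : W ∈ H10 S) (i : Fin N) : ∫ x in S, H1.grad W x i i = 0 := by
  have : IsFiniteMeasure (volume.restrict S) := ⟨by simpa using hb.measure_lt_top⟩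
  let one : Lp ℝ 2 (volume.restrict S) := (memLp_const (1 : ℝ)).toLp _
  have hone : ∀ u : ↥(H1 S), ∫ x in S, H1.grad u x i i = inner ℝ one (H1.gradL S i i u) := by
    intro u
    rw [L2.inner_def]
    refine integral_congr_ae ?_
    filter_upwards [(memLp_const (1 : ℝ)).coeFn_toLp (μ := volume.restrict S) (p := 2),
      H1.gradL_ae_eq u i i] with x h1 h2
    rw [show one x = 1 from h1, h2]
    simp
  refine H10_induction hS (P := fun W => ∫ x in S, H1.grad W x i i = 0) ?_ ?_ hW
  · simp_rw [hone]
    exact isClosed_eq (continuous_const.inner (H1.gradL S i i).continuous) continuous_const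
  · intro u φ h1 h2 h3 _ h5
    have hd : Continuous fun x => fderiv ℝ φ x (e i) :=
      (h1.continuous_fderiv (by simp)).clm_apply continuous_const
    have hdc : HasCompactSupport fun x => fderiv ℝ φ x (e i) := h2.fderiv_apply ℝ (e i)
    have hint : Integrable (fun x => fderiv ℝ φ x (e i)) volume :=
      hd.integrable_of_hasCompactSupport hdc
    have hz : ∫ x, fderiv ℝ φ x (e i) = 0 := by
      have := integral_smul_fderiv_eq_neg_fderiv_smul_of_integrable (μ := volume)
        (f := fun _ : Euc N => (1 : ℝ)) (g := φ) (v := e i) (by simp) (by simpa using hint)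
        (by simpa using h1.continuous.integrable_of_hasCompactSupport h2)
        (fun x _ => differentiableAt_const _) (fun x _ => h1.differentiable (by simp) x)
      simpa using this
    have e1 : ∫ x in S, H1.grad u x i i = ∫ x in S, (fderiv ℝ φ x (e i)) i := by
      refine integral_congr_ae ?_
      filter_upwards [h5 i] with x hx
      rw [← hx]
      rfl
    rw [e1, setIntegral_eq_integral_of_forall_compl_eq_zero]
    · have := (EuclideanSpace.proj i : Euc N →L[ℝ] ℝ).integral_comp_comm hint
      rw [hz, map_zero] at this
      exact this
    · intro x hx
      rw [image_eq_zero_of_notMem_tsupport fun h => hx (h3 (tsupport_fderiv_apply_subset ℝ (e i) h))]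
      rfl

/-- A constant pressure does not contribute to the weak equation. -/
lemma weakDivFree_sigma_iff (hS : IsOpen S) (hb : Bornology.IsBounded S) (p k G : ℝ)
    (u : ↥(H1 S)) : WeakDivFree S (sigma p k G u) ↔ WeakDivFree S (eps k G u) := by
  have : IsFiniteMeasure (volume.restrict S) := ⟨by simpa using hb.measure_lt_top⟩
  refine forall₂_congr fun W hW => ?_
  have hgi : ∀ i, Integrable (fun x => H1.grad W x i i) (volume.restrict S) := fun i =>
    ((Lp.memLp (H1.gradL S i i W)).integrable one_le_two).congr (H1.gradL_ae_eq W i i)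
  have hpt : ∀ x, ∑ i, ∑ j, sigma p k G u x i j * H1.grad W x i j =
      -p * ∑ i, H1.grad W x i i + ∑ i, ∑ j, eps k G u x i j * H1.grad W x i j := by
    intro x
    simp [sigma, add_mul, Finset.sum_add_distrib, Finset.mul_sum]
  simp_rw [hpt]
  rw [integral_add ((integrable_finsetSum _ fun i _ => hgi i).const_mul _)
    (integrable_finsetSum _ fun i _ => integrable_finsetSum _ fun j _ =>
    integrable_eps_mul_grad k G u W i j), integral_const_mul,
    integral_finsetSum _ fun i _ => hgi i]
  simp [integral_grad_diag_eq_zero hS hb hW]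

/-- Two partial derivatives may be exchanged between the factors of `∫ ∂ᵥf ∂_w g`. -/
lemma integral_fderiv_mul_fderiv_comm {f g : Euc N → ℝ} (hf : ContDiff ℝ ∞ f)
    (hfc : HasCompactSupport f) (hg : ContDiff ℝ ∞ g) (v w : Euc N) :
    ∫ x, fderiv ℝ f x v * fderiv ℝ g x w = ∫ x, fderiv ℝ f x w * fderiv ℝ g x v := by
  have hd : ∀ v, ContDiff ℝ 1 fun x => fderiv ℝ g x v := fun v =>
    (hg.fderiv_right (m := 1) (by norm_cast)).clm_apply contDiff_const
  have hfd : ∀ v, Continuous fun x => fderiv ℝ f x v := fun v =>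
    (hf.continuous_fderiv (by simp)).clm_apply continuous_const
  have key : ∀ v w, ∫ x, f x * fderiv ℝ (fun y => fderiv ℝ g y w) x v =
      -∫ x, fderiv ℝ f x v * fderiv ℝ g x w := fun v w => by
    refine integral_mul_fderiv_eq_neg_fderiv_mul_of_integrable ?_ ?_ ?_
      (fun x _ => hf.differentiable (by simp) x) (fun x _ => (hd w).differentiable (by simp) x)
    · exact ((hfd v).mul (hd w).continuous).integrable_of_hasCompactSupport
        ((hfc.fderiv_apply ℝ v).mul_right)
    · exact (hf.continuous.mul (((hd w).continuous_fderiv (by simp)).clm_apply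
        continuous_const)).integrable_of_hasCompactSupport hfc.mul_right
    · exact (hf.continuous.mul (hd w).continuous).integrable_of_hasCompactSupport hfc.mul_right
  have hsymm : ∀ x, fderiv ℝ (fun y => fderiv ℝ g y w) x v =
      fderiv ℝ (fun y => fderiv ℝ g y v) x w := by
    intro x
    have h2 : DifferentiableAt ℝ (fderiv ℝ g) x :=
      (hg.fderiv_right (m := 1) (by norm_cast)).differentiable (by simp) x
    rw [fderiv_clm_apply h2 (differentiableAt_const _),
      fderiv_clm_apply h2 (differentiableAt_const _)]
    have := (hg.contDiffAt (x := x)).isSymmSndFDerivAt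
      (by rw [minSmoothness_of_isRCLikeNormedField]; exact WithTop.coe_le_coe.2 le_top)
    simpa using this v w
  have := key v w
  simp_rw [hsymm, key w v] at this
  exact (neg_injective this).symm

/-- `∫ ∂ᵢWⱼ ∂ⱼWᵢ = ∫ ∂ᵢWᵢ ∂ⱼWⱼ` for `W` in `H¹₀`. -/
lemma inner_gradL_swap (hS : IsOpen S) {W : ↥(H1 S)} (hW : W ∈ H10 S) (i j : Fin N) :
    inner ℝ (H1.gradL S j i W) (H1.gradL S i j W) =
      inner ℝ (H1.gradL S i i W) (H1.gradL S j j W) := by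
  refine H10_induction hS (P := fun W => inner ℝ (H1.gradL S j i W) (H1.gradL S i j W) =
      inner ℝ (H1.gradL S i i W) (H1.gradL S j j W)) ?_ ?_ hW
  · exact isClosed_eq ((H1.gradL S j i).continuous.inner (H1.gradL S i j).continuous)
      ((H1.gradL S i i).continuous.inner (H1.gradL S j j).continuous)
  · intro u φ h1 h2 h3 _ h5
    have hcomp : ∀ i, ContDiff ℝ ∞ fun x => φ x i := fun i =>
      (EuclideanSpace.proj i : Euc N →L[ℝ] ℝ).contDiff.comp h1
    have hcc : ∀ i, HasCompactSupport fun x => φ x i := fun i =>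
      h2.comp_left (g := fun y : Euc N => y i) rfl
    have hfd : ∀ i x v, fderiv ℝ (fun x => φ x i) x v = fderiv ℝ φ x v i := fun i x v => by
      have := ((EuclideanSpace.proj i : Euc N →L[ℝ] ℝ).hasFDerivAt.comp x
        (h1.differentiable (by simp) x).hasFDerivAt).fderiv
      exact congrArg (fun L : Euc N →L[ℝ] ℝ => L v) this
    have hint : ∀ a b c d : Fin N, inner ℝ (H1.gradL S a b u) (H1.gradL S c d u) =
        ∫ x, fderiv ℝ (fun x => φ x c) x (e d) * fderiv ℝ (fun x => φ x a) x (e b) := by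
      intro a b c d
      have hS' : ∫ x in S, fderiv ℝ (fun x => φ x c) x (e d) * fderiv ℝ (fun x => φ x a) x (e b) =
          ∫ x, fderiv ℝ (fun x => φ x c) x (e d) * fderiv ℝ (fun x => φ x a) x (e b) := by
        refine setIntegral_eq_integral_of_forall_compl_eq_zero fun x hx => ?_
        rw [hfd, image_eq_zero_of_notMem_tsupport fun h =>
          hx (h3 (tsupport_fderiv_apply_subset ℝ (e d) h))]
        exact zero_mul _
      rw [L2.inner_def, ← hS']
      refine integral_congr_ae ?_
      filter_upwards [H1.gradL_ae_eq_of_partialL (h5 b) a,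
        H1.gradL_ae_eq_of_partialL (h5 d) c] with x h6 h7
      rw [h6, h7, hfd, hfd]
      rfl
    rw [hint, hint, integral_fderiv_mul_fderiv_comm (hcomp i) (hcc i) (hcomp j)]
    simp_rw [mul_comm]

lemma hasCompactSupport_norm_sq {F : Type*} [NormedAddCommGroup F] {φ : Euc N → F}
    (h : HasCompactSupport φ) : HasCompactSupport fun x => ‖φ x‖ ^ 2 := by
  refine h.mono fun x hx => ?_
  contrapose! hx
  simp only [Function.mem_support, not_not] at hx ⊢
  simp [hx]

lemma integral_coord_mul_inner [NeZero N] {φ : Euc N → Euc N} (h1 : ContDiff ℝ 1 φ)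
    (h2 : HasCompactSupport φ) :
    Integrable (fun x => x 0 * (2 * inner ℝ (φ x) (fderiv ℝ φ x (e 0)))) volume ∧
    ∫ x, x 0 * (2 * inner ℝ (φ x) (fderiv ℝ φ x (e 0))) = -∫ x, ‖φ x‖ ^ 2 := by
  have hdc : Continuous fun x => fderiv ℝ φ x (e 0) :=
    (h1.continuous_fderiv (by simp)).clm_apply continuous_const
  let P : Euc N →L[ℝ] ℝ := EuclideanSpace.proj (0 : Fin N)
  have hP : ∀ x, P x = x 0 := fun _ => rfl
  have hPe : P (e 0) = 1 := by simp [P, e]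
  have hsq : Continuous fun x => ‖φ x‖ ^ 2 := h1.continuous.norm.pow 2
  have hsq' := hasCompactSupport_norm_sq h2
  have hin : Integrable (fun x => P x * (2 * inner ℝ (φ x) (fderiv ℝ φ x (e 0)))) volume := by
    refine (P.continuous.mul (continuous_const.mul
      (h1.continuous.inner hdc))).integrable_of_hasCompactSupport (h2.mono fun x hx => ?_)
    contrapose! hx
    simp only [Function.mem_support, not_not] at hx ⊢
    simp [hx]
  refine ⟨hin, ?_⟩
  have hderiv : ∀ x, HasFDerivAt (fun x => ‖φ x‖ ^ 2)
      (2 • (innerSL ℝ (φ x)).comp (fderiv ℝ φ x)) x := fun x =>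
    (h1.differentiable (by simp) x).hasFDerivAt.norm_sq
  have hval : ∀ x, (2 • (innerSL ℝ (φ x)).comp (fderiv ℝ φ x)) (e 0) =
      2 * inner ℝ (φ x) (fderiv ℝ φ x (e 0)) := fun x => by simp
  have := integral_bilinear_hasFDerivAt_right_eq_neg_left_of_integrable (μ := volume)
    (B := ContinuousLinearMap.mul ℝ ℝ) (f := P) (f' := fun _ => P)
    (g := fun x => ‖φ x‖ ^ 2) (g' := fun x => 2 • (innerSL ℝ (φ x)).comp (fderiv ℝ φ x))
    (v := e 0)
    (by simp only [hPe, ContinuousLinearMap.mul_apply', one_mul]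
        exact hsq.integrable_of_hasCompactSupport hsq')
    (by simp only [hval, ContinuousLinearMap.mul_apply']; exact hin)
    (by simp only [ContinuousLinearMap.mul_apply']
        exact (P.continuous.mul hsq).integrable_of_hasCompactSupport hsq'.mul_left)
    (fun x _ => P.hasFDerivAt) (fun x _ => hderiv x)
  simp only [hval, hPe, ContinuousLinearMap.mul_apply', one_mul, hP] at this
  exact this

/-- The Poincaré inequality for `C¹` fields supported in a ball; it follows from
`∫ |φ|² = -2 ∫ x₁ φ · ∂₁φ`. -/
lemma integral_norm_sq_le [NeZero N] {φ : Euc N → Euc N} (h1 : ContDiff ℝ 1 φ)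
    (h2 : HasCompactSupport φ) {R : ℝ} (hR : tsupport φ ⊆ Metric.closedBall 0 R) :
    ∫ x, ‖φ x‖ ^ 2 ≤ 4 * R ^ 2 * ∫ x, ‖fderiv ℝ φ x (e 0)‖ ^ 2 := by
  have hdc : Continuous fun x => fderiv ℝ φ x (e 0) :=
    (h1.continuous_fderiv (by simp)).clm_apply continuous_const
  have hsq : Integrable (fun x => ‖φ x‖ ^ 2) volume :=
    (h1.continuous.norm.pow 2).integrable_of_hasCompactSupport (hasCompactSupport_norm_sq h2)
  have hdsq : Integrable (fun x => ‖fderiv ℝ φ x (e 0)‖ ^ 2) volume :=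
    (hdc.norm.pow 2).integrable_of_hasCompactSupport
      (hasCompactSupport_norm_sq (h2.fderiv_apply ℝ (e 0)))
  obtain ⟨hin, hibp⟩ := integral_coord_mul_inner h1 h2
  have hle : ∫ x, ‖φ x‖ ^ 2 ≤
      ∫ x, (1 / 2 * ‖φ x‖ ^ 2 + 2 * R ^ 2 * ‖fderiv ℝ φ x (e 0)‖ ^ 2) := by
    rw [← neg_neg (∫ x, ‖φ x‖ ^ 2), ← hibp, ← integral_neg]
    refine integral_mono hin.neg ((hsq.const_mul _).add (hdsq.const_mul _)) fun x => ?_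
    change -(x 0 * (2 * inner ℝ (φ x) (fderiv ℝ φ x (e 0)))) ≤
      1 / 2 * ‖φ x‖ ^ 2 + 2 * R ^ 2 * ‖fderiv ℝ φ x (e 0)‖ ^ 2
    by_cases hx : x ∈ tsupport φ
    · have hxR : ‖x‖ ≤ R := by simpa using hR hx
      have h0 : |x 0| ≤ R := (PiLp.norm_apply_le x 0).trans hxR
      have hcs := abs_real_inner_le_norm (φ x) (fderiv ℝ φ x (e 0))
      have hprod : |x 0 * inner ℝ (φ x) (fderiv ℝ φ x (e 0))| ≤
          R * (‖φ x‖ * ‖fderiv ℝ φ x (e 0)‖) := by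
        rw [abs_mul]
        exact mul_le_mul h0 hcs (abs_nonneg _) ((abs_nonneg _).trans h0)
      have h3 := (abs_le.1 hprod).1
      have h4 := sq_nonneg (‖φ x‖ - 2 * (R * ‖fderiv ℝ φ x (e 0)‖))
      generalize ‖φ x‖ = a at *
      generalize ‖fderiv ℝ φ x (e 0)‖ = b at *
      generalize inner ℝ (φ x) (fderiv ℝ φ x (e 0)) = c at *
      linarith
    · rw [image_eq_zero_of_notMem_tsupport hx, inner_zero_left, mul_zero, mul_zero, neg_zero]
      positivity
  rw [integral_add (hsq.const_mul _) (hdsq.const_mul _), integral_const_mul,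
    integral_const_mul] at hle
  linarith

lemma L2.norm_sq_eq_integral_of_ae_eq {v : L2 S} {ψ : Euc N → Euc N}
    (hv : v =ᵐ[volume.restrict S] ψ) (hs : tsupport ψ ⊆ S) : ‖v‖ ^ 2 = ∫ x, ‖ψ x‖ ^ 2 := by
  have h : ∫ x in S, ‖ψ x‖ ^ 2 = ∫ x, ‖ψ x‖ ^ 2 := by
    refine setIntegral_eq_integral_of_forall_compl_eq_zero fun x hx => ?_
    rw [image_eq_zero_of_notMem_tsupport fun h => hx (hs h)]
    simp
  rw [L2.norm_sq_eq_integral, ← h]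
  exact integral_congr_ae (hv.mono fun x hx => congrArg (‖·‖ ^ 2) hx)

/-- **Poincaré's inequality** in `H¹₀`. -/
lemma poincare [NeZero N] (hS : IsOpen S) {R : ℝ} (hR : S ⊆ Metric.closedBall 0 R) {W : ↥(H1 S)}
    (hW : W ∈ H10 S) : ‖H1.toL2 S W‖ ^ 2 ≤ 4 * R ^ 2 * ‖H1.partialL S 0 W‖ ^ 2 := by
  refine H10_induction hS
    (P := fun W => ‖H1.toL2 S W‖ ^ 2 ≤ 4 * R ^ 2 * ‖H1.partialL S 0 W‖ ^ 2) ?_ ?_ hW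
  · exact isClosed_le ((H1.toL2 S).continuous.norm.pow 2)
      (continuous_const.mul ((H1.partialL S 0).continuous.norm.pow 2))
  · intro u φ h1 h2 h3 h4 h5
    rw [L2.norm_sq_eq_integral_of_ae_eq h4 h3, L2.norm_sq_eq_integral_of_ae_eq (h5 0)
      ((tsupport_fderiv_apply_subset ℝ (e 0)).trans h3)]
    exact integral_norm_sq_le (h1.of_le (by simp)) h2 (h3.trans hR)

/-- **Korn's inequality** in the form needed here: integrating by parts, the mixed terms of the
elastic energy of a field in `H¹₀` add up to the square of its divergence. -/
lemma elasticForm_self_ge (hS : IsOpen S) {k G : ℝ} (hG : 0 < G) (hkG : 0 ≤ k - 2 / 3 * G)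
    {W : ↥(H1 S)} (hW : W ∈ H10 S) :
    G * ∑ j, ‖H1.partialL S j W‖ ^ 2 ≤ elasticForm S k G W W := by
  have hdiv : ∑ i, ∑ j, inner ℝ (H1.gradL S j i W) (H1.gradL S i j W) =
      ‖∑ i, H1.gradL S i i W‖ ^ 2 := by
    rw [← real_inner_self_eq_norm_sq, sum_inner]
    refine Finset.sum_congr rfl fun i _ => ?_
    rw [inner_sum]
    exact Finset.sum_congr rfl fun j _ => inner_gradL_swap hS hW i j
  have hdiag : 0 ≤ ∑ i, ∑ j, (k - 2 / 3 * G) * (if i = j then 1 else 0) *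
      ‖H1.gradL S i j W‖ ^ 2 :=
    Finset.sum_nonneg fun i _ => Finset.sum_nonneg fun j _ => by split_ifs <;> positivity
  have hsum : elasticForm S k G W W =
      ∑ i, ∑ j, (k - 2 / 3 * G) * (if i = j then 1 else 0) * ‖H1.gradL S i j W‖ ^ 2 +
      G * (∑ i, ∑ j, ‖H1.gradL S i j W‖ ^ 2 +
        ∑ i, ∑ j, inner ℝ (H1.gradL S j i W) (H1.gradL S i j W)) := by
    have hij : ∀ i j, inner ℝ (epsL S k G i j W) (H1.gradL S i j W) =
        (k - 2 / 3 * G) * (if i = j then 1 else 0) * ‖H1.gradL S i j W‖ ^ 2 +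
        G * (‖H1.gradL S i j W‖ ^ 2 + inner ℝ (H1.gradL S j i W) (H1.gradL S i j W)) := by
      intro i j
      have h : epsL S k G i j W = ((k - 2 / 3 * G) * (if i = j then 1 else 0)) •
        H1.gradL S i j W + G • (H1.gradL S i j W + H1.gradL S j i W) := rfl
      rw [h, inner_add_left, real_inner_smul_left, real_inner_smul_left, inner_add_left,
        real_inner_self_eq_norm_sq]
    have hdist : ∀ A B C : Fin N → Fin N → ℝ, ∑ i, ∑ j, (A i j + G * (B i j + C i j)) =
        ∑ i, ∑ j, A i j + G * (∑ i, ∑ j, B i j + ∑ i, ∑ j, C i j) := by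
      intro A B C
      simp only [Finset.sum_add_distrib, ← Finset.mul_sum]
    rw [elasticForm_apply, Finset.sum_congr rfl fun i _ => Finset.sum_congr rfl fun j _ => hij i j]
    exact hdist _ _ _
  rw [hsum, hdiv]
  have hG' : ∑ j, ‖H1.partialL S j W‖ ^ 2 = ∑ i, ∑ j, ‖H1.gradL S i j W‖ ^ 2 := by
    simp_rw [H1.norm_partialL_sq]
    exact Finset.sum_comm
  rw [hG', mul_add]
  have : 0 ≤ G * ‖∑ i, H1.gradL S i i W‖ ^ 2 := by positivity
  linarith

/-- The elastic form is coercive on `H¹₀(S)` for bounded `S`. -/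
lemma exists_elasticForm_coercive [NeZero N] (hS : IsOpen S) (hb : Bornology.IsBounded S)
    {k G : ℝ} (hG : 0 < G) (hkG : 0 ≤ k - 2 / 3 * G) :
    ∃ c > 0, ∀ W ∈ H10 S, c * ‖W‖ * ‖W‖ ≤ elasticForm S k G W W := by
  obtain ⟨R, hR⟩ := hb.subset_closedBall 0
  refine ⟨G / (4 * R ^ 2 + 1), by positivity, fun W hW => ?_⟩
  refine le_trans ?_ (elasticForm_self_ge hS hG hkG hW)
  have h0 : ‖H1.partialL S 0 W‖ ^ 2 ≤ ∑ j, ‖H1.partialL S j W‖ ^ 2 :=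
    Finset.single_le_sum (f := fun j => ‖H1.partialL S j W‖ ^ 2) (fun j _ => by positivity)
      (Finset.mem_univ 0)
  have h1 : ‖W‖ ^ 2 ≤ (4 * R ^ 2 + 1) * ∑ j, ‖H1.partialL S j W‖ ^ 2 := by
    rw [H1.norm_sq]
    have := poincare hS hR hW
    have : 4 * R ^ 2 * ‖H1.partialL S 0 W‖ ^ 2 ≤ 4 * R ^ 2 * ∑ j, ‖H1.partialL S j W‖ ^ 2 := by
      gcongr
    linarith
  rw [mul_assoc, ← pow_two, div_mul_eq_mul_div, div_le_iff₀ (by positivity), mul_assoc]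
  rw [mul_comm (4 * R ^ 2 + 1)] at h1
  gcongr

end ElasticForm

/-! ### Solving the homogeneous problem -/

section LaxMilgram

/-- If a bounded bilinear form on a Hilbert space is coercive on a closed subspace `K`, then by the
Lax-Milgram theorem every vector `v` has a correction in `K` that makes it orthogonal to `K` for the
form; the corrected vector depends linearly and continuously on `v`. -/
lemma exists_correction_of_coercive {V : Type*} [NormedAddCommGroup V] [InnerProductSpace ℝ V]
    [CompleteSpace V] (K : Submodule ℝ V) [CompleteSpace K] (B : V →L[ℝ] V →L[ℝ] ℝ) {c : ℝ}
    (hc : 0 < c) (hcoer : ∀ W ∈ K, c * ‖W‖ * ‖W‖ ≤ B W W) :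
    ∃ T : V →L[ℝ] V, ∀ v, T v - v ∈ K ∧ ∀ W ∈ K, B (T v) W = 0 := by
  let B₀ : K →L[ℝ] K →L[ℝ] ℝ := B.bilinearComp K.subtypeL K.subtypeL
  have hB : IsCoercive B₀ := ⟨c, hc, fun W => hcoer W.1 W.2⟩
  let A : V →L[ℝ] V := InnerProductSpace.continuousLinearMapOfBilin (𝕜 := ℝ) B
  let R : V →L[ℝ] K := K.orthogonalProjectionOnto ∘L A
  have hR : ∀ v (W : K), inner ℝ (R v) W = B v W := fun v W => by
    have h1 : inner ℝ (R v) W = inner ℝ (A v) (W : V) :=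
      Submodule.inner_orthogonalProjectionOnto_eq_of_mem_right W (A v)
    rw [h1]
    exact InnerProductSpace.continuousLinearMapOfBilin_apply B v W
  let P : V →L[ℝ] K := (hB.continuousLinearEquivOfBilin.symm : K →L[ℝ] K) ∘L R
  have hP : ∀ v (W : K), B (P v) W = B v W := fun v W => by
    have h1 := hB.continuousLinearEquivOfBilin_apply (P v) W
    have h2 : hB.continuousLinearEquivOfBilin (P v) = R v :=
      hB.continuousLinearEquivOfBilin.apply_symm_apply _
    rw [h2, hR] at h1
    exact h1.symm
  have hT : ∀ v, (ContinuousLinearMap.id ℝ V - K.subtypeL ∘L P) v = v - P v := fun _ => rfl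
  refine ⟨ContinuousLinearMap.id ℝ V - K.subtypeL ∘L P, fun v => ⟨?_, fun W hW => ?_⟩⟩
  · rw [hT, sub_sub_cancel_left]
    exact K.neg_mem (P v).2
  · rw [hT, map_sub, sub_apply, hP v ⟨W, hW⟩, sub_self]

end LaxMilgram

/-! ### Restricting `C²(D̄)` fields to elements of `H¹(S)` -/

section Restriction

variable {N : ℕ} {S D : Set (Euc N)}

lemma continuousOn_ext {F : Type*} [NormedAddCommGroup F] (f : ↥(closure D) →ᵇ F) :
    ContinuousOn (ext f) (closure D) := by
  rw [continuousOn_iff_continuous_domRestrict]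
  exact f.continuous.congr fun x => (ext_apply f x).symm

lemma norm_ext_le {F : Type*} [NormedAddCommGroup F] (f : ↥(closure D) →ᵇ F) {x : Euc N}
    (hx : x ∈ closure D) : ‖ext f x‖ ≤ ‖f‖ := by
  rw [ext_apply f ⟨x, hx⟩]
  exact f.norm_coe_le_norm _

lemma memLp_ext (hS : IsOpen S) (hb : Bornology.IsBounded S) (hSD : S ⊆ closure D)
    (f : ↥(closure D) →ᵇ Euc N) : MemLp (ext f) 2 (volume.restrict S) := by
  have : IsFiniteMeasure (volume.restrict S) := ⟨by simpa using hb.measure_lt_top⟩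
  refine MemLp.of_bound (((continuousOn_ext f).mono hSD).aestronglyMeasurable hS.measurableSet)
    ‖f‖ ?_
  filter_upwards [ae_restrict_mem hS.measurableSet] with x hx
  exact norm_ext_le f (hSD hx)

/-- Restriction of bounded continuous fields on `D̄` to a bounded open set `S ⊆ D̄`, as a continuous
linear map into `L²(S)`. -/
noncomputable def restrictL2 (hS : IsOpen S) (hb : Bornology.IsBounded S) (hSD : S ⊆ closure D) :
    (↥(closure D) →ᵇ Euc N) →L[ℝ] L2 S :=
  LinearMap.mkContinuous
    { toFun := fun f => (memLp_ext hS hb hSD f).toLp _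
      map_add' := fun f g => by
        rw [← MemLp.toLp_add]
        exact MemLp.toLp_congr _ _ (.of_eq (ext_add f g))
      map_smul' := fun c f => by
        rw [RingHom.id_apply, ← MemLp.toLp_const_smul]
        exact MemLp.toLp_congr _ _ (.of_eq (ext_smul c f)) }
    ((volume.restrict S).real Set.univ ^ (2⁻¹ : ℝ)) fun f => by
      have : IsFiniteMeasure (volume.restrict S) := ⟨by simpa using hb.measure_lt_top⟩
      have := Lp.norm_le_of_ae_bound (f := (memLp_ext hS hb hSD f).toLp _) (norm_nonneg f) (by
        filter_upwards [(memLp_ext hS hb hSD f).coeFn_toLp, ae_restrict_mem hS.measurableSet]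
          with x h1 hx
        rw [h1]
        exact norm_ext_le f (hSD hx))
      exact this.trans_eq (by rw [ENNReal.toReal_ofNat]; rfl)

lemma restrictL2_ae_eq (hS : IsOpen S) (hb : Bornology.IsBounded S) (hSD : S ⊆ closure D)
    (f : ↥(closure D) →ᵇ Euc N) : restrictL2 hS hb hSD f =ᵐ[volume.restrict S] ext f :=
  (memLp_ext hS hb hSD f).coeFn_toLp

/-- Every field in `C²(D̄, ℝᴺ)` restricts to an element of `H¹(S)` for bounded open `S ⊆ D`, and the
restriction is linear and continuous. -/
lemma exists_restrictH1 (hS : IsOpen S) (hb : Bornology.IsBounded S) (hSD : S ⊆ D) :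
    ∃ Phi : C2 D (Euc N) →L[ℝ] ↥(H1 S),
      ∀ f, H1.toL2 S (Phi f) =ᵐ[volume.restrict S] C2.fn f := by
  have hSD' := hSD.trans subset_closure
  let V : C2 D (Euc N) →L[ℝ] (↥(closure D) →ᵇ Euc N) × (↥(closure D) →ᵇ (Euc N →L[ℝ] Euc N)) ×
      (↥(closure D) →ᵇ (Euc N →L[ℝ] Euc N →L[ℝ] Euc N)) := (C2Sub D (Euc N)).subtypeL
  let A : C2 D (Euc N) →L[ℝ] L2 S := restrictL2 hS hb hSD' ∘L ContinuousLinearMap.fst ℝ _ _ ∘L V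
  let B : Fin N → C2 D (Euc N) →L[ℝ] L2 S := fun j => restrictL2 hS hb hSD' ∘L
    (ContinuousLinearMap.apply ℝ (Euc N) (e j)).compLeftContinuousBounded ↥(closure D) ∘L
    ContinuousLinearMap.fst ℝ _ _ ∘L ContinuousLinearMap.snd ℝ _ _ ∘L V
  have hA : ∀ f, A f =ᵐ[volume.restrict S] C2.fn f := fun f => restrictL2_ae_eq hS hb hSD' _
  have hB : ∀ f j, B j f =ᵐ[volume.restrict S] fun x => C2.deriv f x (e j) := fun f j => by
    filter_upwards [restrictL2_ae_eq hS hb hSD'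
      ((ContinuousLinearMap.apply ℝ (Euc N) (e j)).compLeftContinuousBounded ↥(closure D)
        (V f).2.1), ae_restrict_mem hS.measurableSet] with x h1 hx
    refine h1.trans ?_
    rw [ext_apply _ ⟨x, hSD' hx⟩, C2.deriv, ext_apply _ ⟨x, hSD' hx⟩]
    rfl
  let Q : C2 D (Euc N) →L[ℝ] WithLp 2 (L2 S × PiLp 2 (fun _ : Fin N => L2 S)) :=
    ((WithLp.prodContinuousLinearEquiv 2 ℝ (L2 S) (PiLp 2 (fun _ : Fin N => L2 S))).symm :
      _ →L[ℝ] WithLp 2 (L2 S × PiLp 2 (fun _ : Fin N => L2 S))) ∘L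
    A.prod (((PiLp.continuousLinearEquiv 2 ℝ (fun _ : Fin N => L2 S)).symm :
      _ →L[ℝ] PiLp 2 (fun _ : Fin N => L2 S)) ∘L ContinuousLinearMap.pi B)
  have hQ : ∀ f, Q f ∈ H1 S := fun f j => by
    refine IsWeakPartial.congr (isWeakPartial_of_hasFDerivAt hS (G := C2.fn f) (G' := C2.deriv f)
      (fun x hx => (f.2 x (hSD hx)).1) ((continuousOn_ext _).mono hSD') j) (hA f).symm (hB f j).symm
  exact ⟨Q.codRestrict (H1 S) hQ, hA⟩

lemma C2.continuousOn_fn (f : C2 D (Euc N)) : ContinuousOn (C2.fn f) (closure D) :=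
  continuousOn_ext _

lemma C2.contDiffOn_fn (hD : IsOpen D) (f : C2 D (Euc N)) : ContDiffOn ℝ 1 (C2.fn f) D := by
  have hf : ∀ x ∈ D, HasFDerivAt (C2.fn f) (C2.deriv f x) x := fun x hx => (f.2 x hx).1
  have h1 : (1 : WithTop ℕ∞) = 0 + 1 := by simp
  rw [h1, contDiffOn_succ_iff_fderiv_of_isOpen hD]
  refine ⟨fun x hx => (hf x hx).differentiableAt.differentiableWithinAt, by simp, ?_⟩
  rw [contDiffOn_zero]
  exact ((continuousOn_ext _).mono subset_closure).congr fun x hx => (hf x hx).fderiv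

end Restriction

/-! ### The Dirichlet problem for the elastomer -/

section Dirichlet

variable {N : ℕ} [NeZero N] (geo : Geometry N)

lemma Geometry.S_open : IsOpen geo.S := geo.D_open.sdiff isClosed_closure

lemma Geometry.S_subset : geo.S ⊆ geo.D := Set.sdiff_subset

lemma Geometry.S_bounded : Bornology.IsBounded geo.S := geo.D_bounded.subset geo.S_subset

variable {geo}

/-- Two fields with the same boundary data differ by an element of `H¹₀(S)`, whatever extensions of
the data are used. -/
lemma Geometry.DirichletCondition.sub_mem {u v : ↥(H1 geo.S)} {mu : ↥geo.Adm}
    (hu : geo.DirichletCondition u mu) (hv : geo.DirichletCondition v mu) : u - v ∈ H10 geo.S := by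
  obtain ⟨g, hg0, hgG, Phi, E, hE1, hE2, hE3, hE4, hE5⟩ := hu
  obtain ⟨h, hh0, hhG, Psi, F, hF1, hF2, hF3, hF4, hF5⟩ := hv
  have hgh : ∀ x ∈ frontier geo.S, g x = h x := by
    intro x hx
    have hx' : x ∈ geo.wallZ ∪ geo.wallS ∪ geo.Gam ∪ geo.wallP := geo.frontier_S ▸ hx
    by_cases hxG : x ∈ geo.Gam
    · rw [hgG x hxG, hhG x hxG]
    · have : x ∈ geo.wallZ ∪ geo.wallS ∪ geo.wallP := by
        simp only [Set.mem_union] at hx' ⊢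
        tauto
      rw [hg0 x this, hh0 x this]
  have hPhi : Phi - Psi ∈ H10 geo.S := by
    refine mem_H10_of_eq_zero_on_frontier geo.S_open geo.S_bounded (hE1.sub hF1) (hE2.sub hF2)
      (fun x hx => ?_) ?_
    · rw [Pi.sub_apply, hE4 x hx, hF4 x hx, hgh x hx, sub_self]
    · rw [map_sub]
      exact (Lp.coeFn_sub _ _).trans (hE3.sub hF3)
  have := (H10 geo.S).add_mem ((H10 geo.S).sub_mem hE5 hF5) hPhi
  convert this using 1
  abel

lemma elasticSolution_unique {k G : ℝ} (hG : 0 < G) (hkG : 0 ≤ k - 2 / 3 * G)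
    {u v : ↥(H1 geo.S)} {mu : ↥geo.Adm} (hu : WeakDivFree geo.S (eps k G u))
    (hv : WeakDivFree geo.S (eps k G v)) (hu' : geo.DirichletCondition u mu)
    (hv' : geo.DirichletCondition v mu) : u = v := by
  have hmem := hu'.sub_mem hv'
  obtain ⟨c, hc, hcoer⟩ := exists_elasticForm_coercive geo.S_open geo.S_bounded hG hkG
  have h0 : elasticForm geo.S k G (u - v) (u - v) = 0 := by
    rw [map_sub (elasticForm geo.S k G), sub_apply,
      (weakDivFree_eps_iff k G u).1 hu _ hmem, (weakDivFree_eps_iff k G v).1 hv _ hmem, sub_zero]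
  have h1 := hcoer _ hmem
  rw [h0, mul_assoc] at h1
  have h2 : ‖u - v‖ * ‖u - v‖ ≤ 0 := nonpos_of_mul_nonpos_right h1 hc
  have h3 : ‖u - v‖ = 0 := mul_self_eq_zero.1 (le_antisymm h2 (mul_self_nonneg _))
  exact sub_eq_zero.1 (norm_eq_zero.1 h3)

variable (geo)

/-- The solution operator `μ ↦ U⁰(μ)` is a continuous linear map. -/
lemma Geometry.exists_solutionOperator {k G : ℝ} (hG : 0 < G) (hkG : 0 ≤ k - 2 / 3 * G) :
    ∃ T : ↥geo.Adm →L[ℝ] ↥(H1 geo.S), ∀ mu,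
      WeakDivFree geo.S (eps k G (T mu)) ∧ geo.DirichletCondition (T mu) mu := by
  obtain ⟨Phi, hPhi⟩ := exists_restrictH1 geo.S_open geo.S_bounded geo.S_subset
  obtain ⟨c, hc, hcoer⟩ := exists_elasticForm_coercive geo.S_open geo.S_bounded hG hkG
  obtain ⟨T, hT⟩ := exists_correction_of_coercive (H10 geo.S) (elasticForm geo.S k G) hc hcoer
  refine ⟨T ∘L Phi ∘L geo.Adm.subtypeL, fun mu => ⟨?_, C2.fn mu.1, fun x hx => ?_,
    fun _ _ => rfl, Phi mu.1, C2.fn mu.1, (C2.continuousOn_fn mu.1).mono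
    (closure_mono geo.S_subset), (C2.contDiffOn_fn geo.D_open mu.1).mono geo.S_subset,
    hPhi mu.1, fun _ _ => rfl, (hT (Phi mu.1)).1⟩⟩
  · exact (weakDivFree_eps_iff k G _).2 (hT (Phi mu.1)).2
  · refine mu.2.1 x ?_
    rw [geo.frontier_D]
    simp only [Set.mem_union] at hx ⊢
    tauto

lemma fderiv_eq_of_eventuallyEq_clm {E F : Type*} [NormedAddCommGroup E] [NormedSpace ℝ E]
    [NormedAddCommGroup F] [NormedSpace ℝ F] {f : E → F} {T : E →L[ℝ] F} {x : E}
    (h : ∀ᶠ y in 𝓝 x, f y = T y) : fderiv ℝ f x = T := by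
  rw [Filter.EventuallyEq.fderiv_eq h, T.fderiv]

end Dirichlet

end PoreElasticity

theorem theorem3 {N : ℕ} [NeZero N] (hN : N = 2 ∨ N = 3)
    (geo : PoreElasticity.Geometry N)
    (p k G : ℝ) (hk : 0 < k) (hG : 0 < G) (hkG : 0 ≤ k - 2 / 3 * G)
    (lam : ↥geo.Adm) :
    (∀ mu : ↥geo.Adm, ∃! u : ↥(PoreElasticity.H1 geo.S), geo.IsWeakSolution p k G mu u) ∧
    ∀ U : ↥geo.Adm → ↥(PoreElasticity.H1 geo.S),
      (∀ᶠ mu in 𝓝 lam, geo.IsWeakSolution p k G mu (U mu)) →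
      (∃ V : Set ↥geo.Adm, IsOpen V ∧ lam ∈ V ∧ ContDiffOn ℝ 1 U V) ∧
      ∀ mu : ↥geo.Adm,
        PoreElasticity.WeakDivFree geo.S (PoreElasticity.eps k G (fderiv ℝ U lam mu)) ∧
        geo.DirichletCondition (fderiv ℝ U lam mu) mu := by
  obtain ⟨T, hT⟩ := geo.exists_solutionOperator hG hkG
  have hsigma := PoreElasticity.weakDivFree_sigma_iff geo.S_open geo.S_bounded p k G
  have huniq : ∀ mu u, geo.IsWeakSolution p k G mu u → u = T mu := fun mu u hu =>
    PoreElasticity.elasticSolution_unique hG hkG ((hsigma u).1 hu.1) (hT mu).1 hu.2 (hT mu).2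
  refine ⟨fun mu => ⟨T mu, ⟨(hsigma _).2 (hT mu).1, (hT mu).2⟩, huniq mu⟩, fun U hU => ?_⟩
  have hUT : ∀ᶠ mu in 𝓝 lam, U mu = T mu := hU.mono fun mu => huniq mu (U mu)
  constructor
  · obtain ⟨V, hV, hVo, hlam⟩ := eventually_nhds_iff.1 hUT
    exact ⟨V, hVo, hlam, T.contDiff.contDiffOn.congr hV⟩
  · intro mu
    rw [PoreElasticity.fderiv_eq_of_eventuallyEq_clm hUT]
    exact hT mu
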